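/- Monoids are considered as algebras of type $(2,0)$. A variety of monoids is the class of all monoids satisfying some set of identities, and $\operatorname{var}\Sigma$ denotes the variety given by the identity system $\Sigma$. A variety is a group variety if all its members are groups, a chain variety if its subvarieties form a chain under inclusion, finitely generated if it is generated by a single finite monoid, and locally finite if all its finitely generated members are finite. Every monoid variety that is a chain variety and is not a group variety is contained in some finitely generated variety of monoids; in particular, it is locally finite. Moreover, the variety $$\mathbf D=\operatorname{var}\{x^2\approx x^3,\ x^2y\approx yx^2,\ xyzxty\approx yxzxty,\ xtyzxy\approx xtyzyx,\ y_1y_0x_1y_1x_0x_1\approx y_1y_0y_1x_1x_0x_1\}$$ is contained in the variety generated by the $6$-element Brandt monoid $B_2^1=B_2\cup\{1\}$, where $$B_2=\langle a,b\mid a^2=b^2=0,\ aba=a,\ bab=b\rangle=\{a,b,ab,ba,0\},$$ and the variety $$\mathbf K=\operatorname{var}\{xyx\approx xyx^2,\ x^2y^2\approx y^2x^2,\ x^2y\approx x^2yx\}$$ is contained in the variety generated by the $5$-element monoid $$\langle a,b\mid a^2=ab=a,\ b^2a=b^2\rangle\cup\{1\}=\{a,b,ba,b^2,1\}.$$ 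-/

import Mathlib

/-! # Varieties of monoids -/

universe u

namespace MonoidVar

/-- Possibly empty words over a countably infinite alphabet. -/
abbrev Word := FreeMonoid ℕ

/-- An identity `p.1 ≈ p.2` in the language of monoids (signature `(2,0)`). -/
abbrev Identity := Word × Word

/-- The monoid `M` satisfies the identity `p`: both sides agree under every substitution of
elements of `M` for the letters. -/
def Satisfies (M : Type u) [Monoid M] (p : Identity) : Prop :=
  ∀ φ : Word →* M, φ p.1 = φ p.2

/-- A variety of monoids: a class of monoids that is defined by some set of identities. -/
@[ext]
structure Variety where
  /-- The class of monoids that belong to the variety. -/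
  carrier : Set MonCat.{u}
  /-- The class is equational. -/
  equational : ∃ E : Set Identity, ∀ M : MonCat.{u}, M ∈ carrier ↔ ∀ p ∈ E, Satisfies M p

namespace Variety

/-- Varieties are ordered by inclusion of classes. -/
instance instPartialOrder : PartialOrder Variety.{u} :=
  PartialOrder.lift Variety.carrier (fun _ _ h => Variety.ext h)

/-- The monoid `M` lies in the variety `V`. -/
def Contains (V : Variety.{u}) (M : Type u) [Monoid M] : Prop :=
  MonCat.of M ∈ V.carrier

/-- `var E`: the variety of all monoids that satisfy the identities in `E`. -/
def ofIdentities (E : Set Identity) : Variety.{u} where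
  carrier := {M | ∀ p ∈ E, Satisfies M p}
  equational := ⟨E, fun _ => Iff.rfl⟩

/-- `var M`: the variety generated by the monoid `M`, consisting of all monoids that satisfy every
identity of `M`. It is the least variety that contains `M`, see `isLeast_generatedBy`. -/
def generatedBy (M : Type u) [Monoid M] : Variety.{u} :=
  ofIdentities {p | Satisfies M p}

theorem isLeast_generatedBy (M : Type u) [Monoid M] :
    IsLeast {V : Variety.{u} | V.Contains M} (generatedBy M) := by
  refine ⟨fun p hp => hp, fun V hV N hN => ?_⟩
  obtain ⟨E, hE⟩ := V.equational
  exact (hE N).2 fun p hp => hN p ((hE (MonCat.of M)).1 hV p hp)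

/-- A group variety: all its members are groups. -/
def IsGroupVariety (V : Variety.{u}) : Prop :=
  ∀ (M : Type u) [Monoid M], V.Contains M → ∀ x : M, IsUnit x

/-- A chain variety: its subvarieties form a chain under inclusion. -/
def IsChainVariety (V : Variety.{u}) : Prop :=
  IsChain (· ≤ ·) {X : Variety.{u} | X ≤ V}

/-- A finitely generated variety: it is generated by a finite monoid. -/
def IsFinitelyGenerated (V : Variety.{u}) : Prop :=
  ∃ (M : Type u) (_ : Monoid M), Finite M ∧ V = generatedBy M

/-- A locally finite variety: all its finitely generated members are finite. -/
def IsLocallyFinite (V : Variety.{u}) : Prop :=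
  ∀ (M : Type u) [Monoid M], V.Contains M → Monoid.FG M → Finite M

end Variety

/-- The `i`-th letter, as a word. -/
def letter (i : ℕ) : Word := FreeMonoid.of i

/-- `x ^ 2 ≈ x ^ 3`, `x ^ 2 * y ≈ y * x ^ 2`, `σ₁ : xyzxty ≈ yxzxty`, `σ₂ : xtyzxy ≈ xtyzyx` and
`γ₁ : y₁y₀x₁y₁x₀x₁ ≈ y₁y₀y₁x₁x₀x₁`. -/
def identitiesD : Set Identity :=
  let x := letter 0; let y := letter 1; let z := letter 2; let t := letter 3
  let x₀ := letter 0; let x₁ := letter 1; let y₀ := letter 2; let y₁ := letter 3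
  { (x ^ 2, x ^ 3),
    (x ^ 2 * y, y * x ^ 2),
    (x * y * z * x * t * y, y * x * z * x * t * y),
    (x * t * y * z * x * y, x * t * y * z * y * x),
    (y₁ * y₀ * x₁ * y₁ * x₀ * x₁, y₁ * y₀ * y₁ * x₁ * x₀ * x₁) }

/-- `xyx ≈ xyx²`, `x²y² ≈ y²x²` and `x²y ≈ x²yx`. -/
def identitiesK : Set Identity :=
  let x := letter 0; let y := letter 1
  { (x * y * x, x * y * x ^ 2),
    (x ^ 2 * y ^ 2, y ^ 2 * x ^ 2),
    (x ^ 2 * y, x ^ 2 * y * x) }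

/-- The variety **D**. -/
def varietyD : Variety.{u} := Variety.ofIdentities identitiesD

/-- The variety **K**. -/
def varietyK : Variety.{u} := Variety.ofIdentities identitiesK

/-- The Brandt semigroup `B₂ = ⟨a, b ∣ a² = b² = 0, aba = a, bab = b⟩ = {a, b, ab, ba, 0}`. -/
inductive B2 : Type
  | a | b | ab | ba | zero
  deriving DecidableEq

namespace B2

/-- The multiplication of `B₂`. -/
def mul : B2 → B2 → B2
  | a, b => ab
  | a, ba => a
  | b, a => ba
  | b, ab => b
  | ab, a => a
  | ab, ab => ab
  | ba, b => b
  | ba, ba => ba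
  | _, _ => zero

instance instSemigroup : Semigroup B2 where
  mul := mul
  mul_assoc x y z := by cases x <;> cases y <;> cases z <;> rfl

theorem relations :
    a * b = ab ∧ b * a = ba ∧ a * a = zero ∧ b * b = zero ∧ a * b * a = a ∧ b * a * b = b ∧
      ∀ x : B2, zero * x = zero ∧ x * zero = zero :=
  ⟨rfl, rfl, rfl, rfl, rfl, rfl, fun x => by cases x <;> exact ⟨rfl, rfl⟩⟩

end B2

/-- The Brandt monoid `B₂ ∪ {1}`, which has six elements. -/
abbrev BrandtMonoid : Type := WithOne B2

/-- The semigroup `⟨a, b ∣ a² = ab = a, b²a = b²⟩ = {a, b, ba, b²}`; here `bb` is `b²`. -/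
inductive S4 : Type
  | a | b | ba | bb
  deriving DecidableEq

namespace S4

/-- The multiplication of `S4`. -/
def mul : S4 → S4 → S4
  | a, _ => a
  | b, a => ba
  | b, b => bb
  | b, ba => bb
  | b, bb => bb
  | ba, _ => ba
  | bb, _ => bb

instance instSemigroup : Semigroup S4 where
  mul := mul
  mul_assoc x y z := by cases x <;> cases y <;> cases z <;> rfl

theorem relations :
    b * a = ba ∧ b * b = bb ∧ a * a = a ∧ a * b = a ∧ b * b * a = b * b :=
  ⟨rfl, rfl, rfl, rfl, rfl⟩

end S4

/-- The monoid `⟨a, b ∣ a² = ab = a, b²a = b²⟩ ∪ {1} = {a, b, ba, b², 1}`, which has five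
elements. -/
abbrev FiveMonoid : Type := WithOne S4

end MonoidVar

/-! ### Identities as pairs of lists, comparison of members of a chain variety, and duality. -/

namespace MonoidVar

/-! Suppose that in every member of a variety a letter may be deleted once `n` copies of it stand to
its left (`Absorbs`), or dually to its right (`CoAbsorbs`). Then every word equals its truncation,
which keeps at most `n` copies of each letter. A truncation is determined by its restrictions to two
letters, and over two letters there are finitely many truncations. So a single finite monoid,
`TruncMonoid n` or its opposite, generates a variety containing the given one. Local finiteness
follows, since a finite monoid generates a locally finite variety.

The chain condition enters through `not_separated`: two members cannot be separated by identities in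
both directions. The test monoids are cyclic groups, the two-element left zero semigroup with `1`,
the monoid `E0`, and the Rees quotients `FactorMonoid w`, which belong to the variety when `w` is an
isoterm. Comparing cyclic groups with `{1, 0}` gives `x^n ≈ x^(n+1)`. A commutative variety then
absorbs at depth `n`, and a variety of bands absorbs at depth 1 on one side. In the remaining case
`x² ≈ x³` holds. If `E0` or its opposite is present, the variety absorbs at depth 2 on one side.
Otherwise squares are central; then either `xyxzx` is not an isoterm and absorption at depth 3
follows, or all laws of `D` hold and the variety lies in `var B₂¹`.

For `D ≤ var B₂¹`, adjacent occurrences of repeated letters commute in `D`, so only the position of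
each letter relative to the letters occurring once matters, and `B₂¹` detects this up to central
squares. For `K`, the five-element monoid detects the order of first occurrences and which letters
repeat, and this determines the value of a word in `K`. -/

/-- The identity `u ≈ v` between words, given as lists of letters, holds in `M`. -/
def Holds (M : Type u) [Monoid M] (u v : List ℕ) : Prop :=
  ∀ f : ℕ → M, (u.map f).prod = (v.map f).prod

theorem satisfies_iff_holds {M : Type u} [Monoid M] {p : Identity} :
    Satisfies M p ↔ Holds M p.1.toList p.2.toList := by
  constructor
  · intro h f
    simpa [FreeMonoid.lift_apply] using h (FreeMonoid.lift f)
  · intro h φ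
    have := h (fun i => φ (FreeMonoid.of i))
    rw [← FreeMonoid.lift_apply, ← FreeMonoid.lift_apply] at this
    have e : FreeMonoid.lift (fun i => φ (FreeMonoid.of i)) = φ := by
      ext i; simp
    rwa [e] at this

theorem Holds.symm {M : Type u} [Monoid M] {u v : List ℕ} (h : Holds M u v) : Holds M v u :=
  fun f => (h f).symm

theorem holds_ulift {M : Type} [Monoid M] {u v : List ℕ} :
    Holds (ULift.{u} M) u v ↔ Holds M u v := by
  have key : ∀ (f : ℕ → ULift.{u} M) (l : List ℕ),
      (l.map f).prod.down = (l.map fun i => (f i).down).prod := by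
    intro f l
    induction l with
    | nil => rfl
    | cons a l ih => simp [ih]
  constructor
  · intro h f
    have := congrArg ULift.down (h fun i => ⟨f i⟩)
    simpa [key] using this
  · intro h f
    apply ULift.ext
    rw [key, key]
    exact h _

theorem holds_mulOpposite {M : Type u} [Monoid M] {u v : List ℕ} :
    Holds Mᵐᵒᵖ u v ↔ Holds M u.reverse v.reverse := by
  have key : ∀ (f : ℕ → Mᵐᵒᵖ) (l : List ℕ),
      (l.map f).prod.unop = (l.reverse.map fun i => (f i).unop).prod := by
    intro f l
    rw [MulOpposite.unop_list_prod, List.map_map, List.map_reverse]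
    rfl
  constructor
  · intro h f
    have := congrArg MulOpposite.unop (h fun i => MulOpposite.op (f i))
    simpa [key] using this
  · intro h f
    apply MulOpposite.unop_injective
    rw [key, key]
    exact h _

/-- Substitute `1` for the deleted letters. -/
theorem Holds.filter {M : Type u} [Monoid M] {u v : List ℕ} (h : Holds M u v)
    (p : ℕ → Bool) : Holds M (u.filter p) (v.filter p) := by
  have key : ∀ (f : ℕ → M) (l : List ℕ),
      ((l.filter p).map f).prod = (l.map fun i => if p i then f i else 1).prod := by
    intro f l
    induction l with
    | nil => rfl
    | cons a l ih => by_cases hp : p a <;> simp [hp, ih]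
  intro f
  rw [key, key]
  exact h _

theorem prod_map_eq_pow {M : Type u} [Monoid M] (f : ℕ → M) (x : ℕ) (l : List ℕ)
    (h : ∀ z ∈ l, z ≠ x → f z = 1) : (l.map f).prod = f x ^ l.count x := by
  induction l with
  | nil => simp
  | cons a l ih =>
    have ih := ih fun z hz => h z (List.mem_cons_of_mem _ hz)
    by_cases ha : a = x
    · subst ha
      simp [ih, pow_succ']
    · simp [ih, h a List.mem_cons_self ha, ha]

namespace Variety

/-- The identity `u ≈ v` holds in the variety `V`. -/
def Id (V : Variety.{u}) (u v : List ℕ) : Prop :=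
  ∀ (M : Type u) [Monoid M], V.Contains M → Holds M u v

/-- The small monoid `M` lies, up to a universe lift, in the variety `V`. -/
def Has (V : Variety.{u}) (M : Type) [Monoid M] : Prop := V.Contains (ULift.{u} M)

theorem contains_iff {V : Variety.{u}} {M : Type u} [Monoid M] :
    V.Contains M ↔ ∀ u v, V.Id u v → Holds M u v := by
  constructor
  · intro h u v huv
    exact huv M h
  · intro h
    obtain ⟨E, hE⟩ := V.equational
    refine (hE _).2 fun p hp => satisfies_iff_holds.2 (h _ _ fun N _ hN => ?_)
    exact satisfies_iff_holds.1 ((hE (MonCat.of N)).1 hN p hp)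

theorem has_iff {V : Variety.{u}} {M : Type} [Monoid M] :
    V.Has M ↔ ∀ u v, V.Id u v → Holds M u v := by
  simp only [Has, contains_iff, holds_ulift]

theorem Id.symm {V : Variety.{u}} {u v : List ℕ} (h : V.Id u v) : V.Id v u :=
  fun M _ hM => (h M hM).symm

theorem contains_generatedBy_iff {M N : Type u} [Monoid M] [Monoid N] :
    (generatedBy M).Contains N ↔ ∀ u v, Holds M u v → Holds N u v := by
  constructor
  · intro h u v huv
    exact satisfies_iff_holds.1 (h (FreeMonoid.ofList u, FreeMonoid.ofList v)
      (satisfies_iff_holds.2 huv))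
  · intro h p hp
    exact satisfies_iff_holds.2 (h _ _ (satisfies_iff_holds.1 hp))

theorem le_generatedBy_iff {V : Variety.{u}} {M : Type} [Monoid M] :
    V ≤ generatedBy (ULift.{u} M) ↔
      ∀ (N : Type u) [Monoid N], V.Contains N → ∀ u v, Holds M u v → Holds N u v := by
  constructor
  · intro h N _ hN u v huv
    exact contains_generatedBy_iff.1 (h hN) u v (holds_ulift.2 huv)
  · intro h N hN
    exact contains_generatedBy_iff (N := N).2
      fun u v huv => h N hN u v (holds_ulift.1 huv)

theorem IsChainVariety.comparable {V : Variety.{u}} (hV : V.IsChainVariety) {M N : Type}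
    [Monoid M] [Monoid N] (hM : V.Has M) (hN : V.Has N) :
    (∀ u v, Holds M u v → Holds N u v) ∨ ∀ u v, Holds N u v → Holds M u v := by
  have h1 := (isLeast_generatedBy (ULift.{u} M)).2 hM
  have h2 := (isLeast_generatedBy (ULift.{u} N)).2 hN
  have hN' := (isLeast_generatedBy (ULift.{u} N)).1
  have hM' := (isLeast_generatedBy (ULift.{u} M)).1
  rcases hV.total h1 h2 with h | h
  · right
    intro u v huv
    exact le_generatedBy_iff.1 h (ULift.{u} M) hM' u v huv |> holds_ulift.1
  · left
    intro u v huv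
    exact le_generatedBy_iff.1 h (ULift.{u} N) hN' u v huv |> holds_ulift.1

/-- Two monoids of a chain variety cannot be separated by identities in both directions. -/
theorem IsChainVariety.not_separated {V : Variety.{u}} (hV : V.IsChainVariety) {M N : Type}
    [Monoid M] [Monoid N] (hM : V.Has M) (hN : V.Has N) {u v u' v' : List ℕ}
    (h1 : Holds M u v) (h2 : ¬ Holds N u v) (h3 : Holds N u' v') (h4 : ¬ Holds M u' v') :
    False := by
  rcases hV.comparable hM hN with h | h
  · exact h2 (h _ _ h1)
  · exact h4 (h _ _ h3)

/-- The dual variety: the opposites of the members of `V`. -/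
def op (V : Variety.{u}) : Variety.{u} where
  carrier := {M | V.Contains Mᵐᵒᵖ}
  equational := by
    refine ⟨{p | V.Id p.1.toList.reverse p.2.toList.reverse}, fun M => ?_⟩
    change V.Contains Mᵐᵒᵖ ↔ _
    rw [contains_iff]
    simp only [holds_mulOpposite, satisfies_iff_holds, Set.mem_ofPred_eq]
    constructor
    · intro h p hp
      simpa using h _ _ hp
    · intro h u v huv
      have := h (FreeMonoid.ofList u.reverse, FreeMonoid.ofList v.reverse)
      simpa [huv] using this

theorem op_contains {V : Variety.{u}} {M : Type u} [Monoid M] :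
    V.op.Contains M ↔ V.Contains Mᵐᵒᵖ := Iff.rfl

theorem contains_op_op {V : Variety.{u}} {M : Type u} [Monoid M] :
    V.op.Contains Mᵐᵒᵖ ↔ V.Contains M := by
  rw [op_contains, contains_iff, contains_iff]
  simp [holds_mulOpposite]

theorem op_id {V : Variety.{u}} {u v : List ℕ} : V.op.Id u v ↔ V.Id u.reverse v.reverse := by
  constructor
  · intro h M _ hM
    exact holds_mulOpposite.1 (h Mᵐᵒᵖ (contains_op_op.2 hM))
  · intro h M _ hM
    simpa [holds_mulOpposite] using h Mᵐᵒᵖ hM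

theorem op_has {V : Variety.{u}} {M : Type} [Monoid M] : V.op.Has M ↔ V.Has Mᵐᵒᵖ := by
  simp only [has_iff, op_id, holds_mulOpposite]
  constructor
  · intro h u v huv
    exact h _ _ (by simpa using huv)
  · intro h u v huv
    simpa using h _ _ huv

theorem op_op (V : Variety.{u}) : V.op.op = V := by
  ext M
  exact contains_op_op (M := M)

theorem op_mono {V W : Variety.{u}} (h : V ≤ W) : V.op ≤ W.op := fun M hM =>
  h (show MonCat.of (M : Type u)ᵐᵒᵖ ∈ V.carrier from hM)

theorem IsChainVariety.op {V : Variety.{u}} (hV : V.IsChainVariety) : V.op.IsChainVariety := by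
  intro X hX Y hY hne
  have hX' : X.op ≤ V := by simpa [op_op] using op_mono hX
  have hY' : Y.op ≤ V := by simpa [op_op] using op_mono hY
  rcases hV.total hX' hY' with h | h
  · left; simpa [op_op] using op_mono h
  · right; simpa [op_op] using op_mono h

theorem IsGroupVariety.op {V : Variety.{u}} (hV : V.op.IsGroupVariety) : V.IsGroupVariety := by
  intro M _ hM x
  have := hV Mᵐᵒᵖ (contains_op_op.2 hM) (MulOpposite.op x)
  obtain ⟨w, hw⟩ := this
  exact ⟨⟨x, (w⁻¹).1.unop, by
    have := congrArg MulOpposite.unop w.inv_mul; simpa [hw] using this, by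
    have := congrArg MulOpposite.unop w.mul_inv; simpa [hw] using this⟩, rfl⟩

end Variety

end MonoidVar

/-! ### Truncation of words, the finite monoids that recognise it, and local finiteness. -/

namespace MonoidVar

/-- `truncate n l` keeps the last `n` occurrences of every letter of `l`. -/
def truncate {α : Type*} [DecidableEq α] (n : ℕ) : List α → List α
  | [] => []
  | a :: l => if (truncate n l).count a < n then a :: truncate n l else truncate n l

/-- A letter can be deleted if it occurs at least `n` times further to the right. -/
def CoAbsorbs (n : ℕ) (M : Type u) [Monoid M] : Prop :=
  ∀ (f : ℕ → M) (u : List ℕ) (x : ℕ), n ≤ u.count x → f x * (u.map f).prod = (u.map f).prod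

/-- A letter can be deleted if it occurs at least `n` times further to the left. -/
def Absorbs (n : ℕ) (M : Type u) [Monoid M] : Prop :=
  ∀ (f : ℕ → M) (u : List ℕ) (x : ℕ), n ≤ u.count x → (u.map f).prod * f x = (u.map f).prod

theorem absorbs_mulOpposite_iff {n : ℕ} {M : Type u} [Monoid M] :
    CoAbsorbs n Mᵐᵒᵖ ↔ Absorbs n M := by
  have key : ∀ (f : ℕ → Mᵐᵒᵖ) (l : List ℕ),
      (l.map f).prod.unop = (l.reverse.map fun i => (f i).unop).prod := by
    intro f l
    rw [MulOpposite.unop_list_prod, List.map_map, List.map_reverse]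
    rfl
  constructor
  · intro h f u x hx
    have := congrArg MulOpposite.unop
      (h (fun i => MulOpposite.op (f i)) u.reverse x (by simpa using hx))
    rw [MulOpposite.unop_mul, key] at this
    simpa using this
  · intro h f u x hx
    apply MulOpposite.unop_injective
    rw [MulOpposite.unop_mul, key]
    exact h _ _ _ (by simpa using hx)

/-- A letter is dropped only when the truncated tail already contains `n` copies of it, and by
induction that tail has the value of the full tail. -/
theorem CoAbsorbs.prod_truncate {n : ℕ} {M : Type u} [Monoid M] (h : CoAbsorbs n M)
    (f : ℕ → M) (u : List ℕ) : ((truncate n u).map f).prod = (u.map f).prod := by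
  induction u with
  | nil => rfl
  | cons a u ih =>
    rw [truncate]
    split_ifs with hc
    · simp [ih]
    · rw [List.map_cons, List.prod_cons, ← ih, h f _ a (not_lt.1 hc)]

/-- The states of the automaton that computes truncations over a two-letter alphabet. -/
def TruncState (n : ℕ) : Type := {l : List Bool // ∀ b, l.count b ≤ n}

instance finite_truncState (n : ℕ) : Finite (TruncState n) := by
  have : {l : List Bool | ∀ b, l.count b ≤ n} ⊆ {l | l.length ≤ 2 * n} := by
    intro l hl
    have h1 := hl true
    have h2 := hl false
    have := List.count_true_add_count_false l
    simp only [Set.mem_ofPred_eq]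
    omega
  exact ((List.finite_length_le Bool (2 * n)).subset this).to_subtype

/-- The action of an optional letter on truncated words. -/
def truncStep (n : ℕ) : Option Bool → TruncState n → TruncState n
  | none, s => s
  | some b, s => if h : s.1.count b < n then ⟨b :: s.1, fun c => by
      by_cases hc : b = c
      · subst hc; rw [List.count_cons_self]; exact h
      · rw [List.count_cons_of_ne hc]; exact s.2 c⟩ else s

theorem truncStep_some_val (n : ℕ) (b : Bool) (s : TruncState n) :
    (truncStep n (some b) s).1 = if s.1.count b < n then b :: s.1 else s.1 := by
  by_cases h : s.1.count b < n
  · rw [if_pos h]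
    exact congrArg Subtype.val (dif_pos h)
  · rw [if_neg h]
    exact congrArg Subtype.val (dif_neg h)

/-- A finite monoid whose identities are the pairs of words all of whose restrictions to two
letters have equal truncations. -/
abbrev TruncMonoid (n : ℕ) : Type := Function.End (TruncState n)

instance finite_truncMonoid (n : ℕ) : Finite (TruncMonoid n) :=
  inferInstanceAs (Finite (TruncState n → TruncState n))

instance finite_truncMonoid_mulOpposite (n : ℕ) : Finite (TruncMonoid n)ᵐᵒᵖ :=
  Finite.of_equiv _ MulOpposite.opEquiv

/-- Restriction of a word to two letters. -/
def pairLetter (x y z : ℕ) : Option Bool :=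
  if z = x then some true else if z = y then some false else none

/-- If the first letters `a` and `b` differ, the restrictions to `{a, b}` already start differently.
-/
theorem list_eq_of_filterMap_pairLetter {l m : List ℕ}
    (h : ∀ x y, l.filterMap (pairLetter x y) = m.filterMap (pairLetter x y)) : l = m := by
  induction l generalizing m with
  | nil =>
    cases m with
    | nil => rfl
    | cons b m => simpa [pairLetter] using h b b
  | cons a l ih =>
    cases m with
    | nil => simpa [pairLetter] using h a a
    | cons b m =>
      have hab : a = b := by
        by_contra hab
        have := h a b
        simp [pairLetter, Ne.symm hab] at this
      subst hab
      congr 1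
      apply ih
      intro x y
      have := h x y
      rw [List.filterMap_cons, List.filterMap_cons] at this
      cases hp : pairLetter x y a <;> simpa [hp] using this

theorem count_filterMap_pairLetter {x y z : ℕ} {b : Bool} (h : pairLetter x y z = some b)
    (l : List ℕ) : (l.filterMap (pairLetter x y)).count b = l.count z := by
  induction l with
  | nil => rfl
  | cons a l ih =>
    rw [List.filterMap_cons]
    by_cases ha : a = z
    · subst ha
      simp [h, ih]
    · rw [List.count_cons_of_ne ha, ← ih]
      cases hp : pairLetter x y a with
      | none => rfl
      | some c =>
        have : c ≠ b := by
          rintro rfl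
          unfold pairLetter at h hp
          split_ifs at h hp <;> simp_all
        simp [List.count_cons_of_ne this]

/-- The action of letters on truncated words that forgets all letters except `x` and `y`. -/
def truncAct (n x y z : ℕ) : TruncMonoid n := truncStep n (pairLetter x y z)

/-- Composition in `Function.End` applies the last letter first, matching the right-to-left
recursion of `truncate`. The automaton sees only `x` and `y`, but the decision to keep a letter
depends only on the count of that letter. -/
theorem truncMonoid_prod_apply (n x y : ℕ) (u : List ℕ) (s : TruncState n) (hs : s.1 = []) :
    ((u.map (truncAct n x y)).prod s).1 =
      (truncate n u).filterMap (pairLetter x y) := by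
  induction u with
  | nil => exact hs
  | cons a u ih =>
    rw [List.map_cons, List.prod_cons, truncate]
    change (truncStep n (pairLetter x y a) ((u.map (truncAct n x y)).prod s)).1 = _
    generalize (u.map (truncAct n x y)).prod s = s' at ih ⊢
    cases hp : pairLetter x y a with
    | none =>
      rw [truncStep, ih]
      split_ifs <;> simp [hp]
    | some b =>
      have hc := count_filterMap_pairLetter hp (truncate n u)
      refine (truncStep_some_val n b s').trans ?_
      rw [ih, hc]
      split_ifs <;> simp [hp]

theorem truncate_eq_of_holds {n : ℕ} {u v : List ℕ} (h : Holds (TruncMonoid n) u v) :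
    truncate n u = truncate n v := by
  apply list_eq_of_filterMap_pairLetter
  intro x y
  let s : TruncState n := ⟨[], fun _ => Nat.zero_le n⟩
  exact (truncMonoid_prod_apply n x y u s rfl).symm.trans
    ((congrArg (fun g : TruncMonoid n => (g s).1) (h (truncAct n x y))).trans
      (truncMonoid_prod_apply n x y v s rfl))

theorem CoAbsorbs.holds {n : ℕ} {M : Type u} [Monoid M] (h : CoAbsorbs n M) {u v : List ℕ}
    (huv : Holds (TruncMonoid n) u v) : Holds M u v := fun f => by
  rw [← h.prod_truncate f u, ← h.prod_truncate f v, truncate_eq_of_holds huv]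

theorem Absorbs.holds {n : ℕ} {M : Type u} [Monoid M] (h : Absorbs n M) {u v : List ℕ}
    (huv : Holds (TruncMonoid n)ᵐᵒᵖ u v) : Holds M u v := by
  have := (absorbs_mulOpposite_iff.2 h).holds (holds_mulOpposite.1 huv)
  simpa [holds_mulOpposite] using this

namespace Variety

theorem isFinitelyGenerated_generatedBy {M : Type} [Monoid M] [Finite M] :
    (generatedBy (ULift.{u} M)).IsFinitelyGenerated :=
  ⟨ULift.{u} M, inferInstance, inferInstance, rfl⟩

/-- A word in `n` generators acts through the function `P^n → P` that it induces on the finite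
generating monoid `P`. Words inducing the same function are identified in `M`, and there are
finitely many functions. -/
theorem IsFinitelyGenerated.isLocallyFinite {V W : Variety.{u}} (hW : W.IsFinitelyGenerated)
    (hVW : V ≤ W) : V.IsLocallyFinite := by
  obtain ⟨P, _, _, rfl⟩ := hW
  intro M _ hM hfg
  have hM : ∀ u v, Holds P u v → Holds M u v := contains_generatedBy_iff.1 (hVW hM)
  obtain ⟨S, hS⟩ := hfg.fg_top
  let n := S.card
  -- The value `1` on surplus letters lets them be erased, leaving words in the first `n` letters.
  let g : ℕ → M := fun i => if h : i < n then (S.equivFin.symm ⟨i, h⟩ : M) else 1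
  let ev : List ℕ → ((Fin n → P) → P) := fun l f =>
    (l.map fun i => if h : i < n then f ⟨i, h⟩ else 1).prod
  have key : ∀ u v, ev u = ev v → (u.map g).prod = (v.map g).prod := by
    intro u v huv
    have h1 : ∀ l : List ℕ, (l.map g).prod = ((l.filter (· < n)).map g).prod := by
      intro l
      induction l with
      | nil => rfl
      | cons a l ih => by_cases ha : a < n <;> simp [ha, ih, g]
    have h2 : ∀ (f : ℕ → P) (l : List ℕ),
        ((l.filter (· < n)).map f).prod = ev l fun i => f i := by
      intro f l
      induction l with
      | nil => rfl
      | cons a l ih => by_cases ha : a < n <;> simp [ha, ih, ev]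
    rw [h1 u, h1 v]
    refine hM _ _ (fun f => ?_) g
    rw [h2 f u, h2 f v, huv]
  have surj : ∀ m : M, ∃ l : List ℕ, (l.map g).prod = m := by
    intro m
    have hm : m ∈ Submonoid.closure (S : Set M) := by rw [hS]; trivial
    induction hm using Submonoid.closure_induction with
    | mem x hx =>
      refine ⟨[S.equivFin ⟨x, hx⟩], ?_⟩
      simp [g, n]
    | one => exact ⟨[], rfl⟩
    | mul x y _ _ hx hy =>
      obtain ⟨l, rfl⟩ := hx
      obtain ⟨l', rfl⟩ := hy
      exact ⟨l ++ l', by simp⟩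
  choose w hw using surj
  refine Finite.of_injective (fun m => ev (w m)) fun a b hab => ?_
  rw [← hw a, ← hw b]
  exact key _ _ hab

theorem exists_isFinitelyGenerated_of_coAbsorbs {V : Variety.{u}} {n : ℕ}
    (h : ∀ (M : Type u) [Monoid M], V.Contains M → CoAbsorbs n M) :
    ∃ W : Variety.{u}, W.IsFinitelyGenerated ∧ V ≤ W :=
  ⟨_, isFinitelyGenerated_generatedBy (M := TruncMonoid n),
    le_generatedBy_iff.2 fun N _ hN _ _ huv => (h N hN).holds huv⟩

theorem exists_isFinitelyGenerated_of_absorbs {V : Variety.{u}} {n : ℕ}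
    (h : ∀ (M : Type u) [Monoid M], V.Contains M → Absorbs n M) :
    ∃ W : Variety.{u}, W.IsFinitelyGenerated ∧ V ≤ W :=
  ⟨_, isFinitelyGenerated_generatedBy (M := (TruncMonoid n)ᵐᵒᵖ),
    le_generatedBy_iff.2 fun N _ hN _ _ huv => (h N hN).holds huv⟩

end Variety

end MonoidVar

/-! ### The variety `K` and the five-element monoid. -/

namespace MonoidVar

theorem exists_eq_append_of_two_le_count {x : ℕ} {u : List ℕ} (h : 2 ≤ u.count x) :
    ∃ p q r, u = p ++ x :: (q ++ x :: r) := by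
  have hx : x ∈ u := List.count_pos_iff.1 (by omega)
  obtain ⟨p, s, rfl, hp⟩ := List.eq_append_cons_of_mem hx
  have hs : x ∈ s := by
    rw [List.count_append, List.count_cons_self, List.count_eq_zero.2 hp] at h
    exact List.count_pos_iff.1 (by omega)
  obtain ⟨q, r, rfl⟩ := List.append_of_mem hs
  exact ⟨p, q, r, rfl⟩

section FiveMonoid

/-- The first law turns the second occurrence of `x` into a square, and by the other law a square of
`x` absorbs a later `x`. -/
theorem absorbs_two {M : Type u} [Monoid M] (h1 : ∀ x y : M, x * y * x = x * y * x ^ 2)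
    (h2 : ∀ x y : M, x ^ 2 * y = x ^ 2 * y * x) : Absorbs 2 M := by
  intro f u x hx
  obtain ⟨p, q, r, rfl⟩ := exists_eq_append_of_two_le_count hx
  simp only [List.map_append, List.map_cons, List.prod_append, List.prod_cons]
  have e1 := h1 (f x) (q.map f).prod
  have e2 := h2 (f x) (r.map f).prod
  generalize (q.map f).prod = Q at *
  generalize (r.map f).prod = R at *
  generalize (p.map f).prod = P at *
  generalize f x = X at *
  have : X * Q * X * R * X = X * Q * X * R := by
    rw [e1, mul_assoc _ _ R, mul_assoc _ _ X, ← e2]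
  simpa [mul_assoc] using congrArg (P * ·) this

/-- After a prefix containing them, `x` and `y` may be replaced by their squares, which commute. -/
theorem prod_append_swap {M : Type u} [Monoid M] (h1 : ∀ x y : M, x * y * x = x * y * x ^ 2)
    (h2 : ∀ x y : M, x ^ 2 * y ^ 2 = y ^ 2 * x ^ 2) (f : ℕ → M) {p : List ℕ} {x y : ℕ}
    (hx : x ∈ p) (hy : y ∈ p) :
    (p.map f).prod * f x * f y = (p.map f).prod * f y * f x := by
  have sq : ∀ p : List ℕ, ∀ x ∈ p, (p.map f).prod * f x = (p.map f).prod * f x ^ 2 := by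
    intro p x hx
    obtain ⟨q, r, rfl⟩ := List.append_of_mem hx
    simp only [List.map_append, List.map_cons, List.prod_append, List.prod_cons]
    simpa [mul_assoc] using congrArg ((q.map f).prod * ·) (h1 (f x) (r.map f).prod)
  have sq2 : ∀ x ∈ p, ∀ y ∈ p,
      (p.map f).prod * f x * f y = (p.map f).prod * f x ^ 2 * f y ^ 2 := by
    intro x hx y hy
    have e := sq (p ++ [x]) y (by simp [hy])
    simp only [List.map_append, List.map_cons, List.map_nil, List.prod_append, List.prod_cons,
      List.prod_nil, mul_one] at e
    rw [e, sq p x hx]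
  rw [sq2 x hx y hy, sq2 y hy x hx, mul_assoc, h2, ← mul_assoc]

theorem prod_append_comm {M : Type u} [Monoid M] (h1 : ∀ x y : M, x * y * x = x * y * x ^ 2)
    (h2 : ∀ x y : M, x ^ 2 * y ^ 2 = y ^ 2 * x ^ 2) (f : ℕ → M) {p w w' : List ℕ}
    (hw : w ⊆ p) (hw' : w' ⊆ p) :
    ((p ++ w ++ w').map f).prod = ((p ++ w' ++ w).map f).prod := by
  have one : ∀ (w p : List ℕ) (x : ℕ), w ⊆ p → x ∈ p →
      ((p ++ w ++ [x]).map f).prod = ((p ++ [x] ++ w).map f).prod := by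
    intro w
    induction w with
    | nil => intro p x _ _; simp
    | cons a w ih =>
      intro p x hw hx
      have e1 := ih (p ++ [a]) x (by
        intro z hz; simp [hw (List.mem_cons_of_mem a hz)]) (by simp [hx])
      have e2 := prod_append_swap h1 h2 f (hw List.mem_cons_self) hx
      simp only [List.map_append, List.map_cons, List.map_nil, List.prod_append, List.prod_cons,
        List.prod_nil, mul_one, ← mul_assoc] at e1 e2 ⊢
      rw [e1, e2]
  induction w' generalizing p with
  | nil => simp
  | cons b w' ih =>
    have hb : b ∈ p := hw' List.mem_cons_self
    have e1 := one w p b hw hb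
    have e2 := ih (p := p ++ [b]) (fun z hz => by simp [hw hz])
      (fun z hz => by simp [hw' (List.mem_cons_of_mem b hz)])
    simp only [List.map_append, List.map_cons, List.map_nil, List.prod_append, List.prod_cons,
      List.prod_nil, mul_one, ← mul_assoc] at e1 e2 ⊢
    rw [e1, e2]

theorem Absorbs.prod_append_eq {n : ℕ} {M : Type u} [Monoid M] (h : Absorbs n M) (f : ℕ → M)
    {p w : List ℕ} (hw : ∀ x ∈ w, n ≤ p.count x) :
    ((p ++ w).map f).prod = (p.map f).prod := by
  induction w generalizing p with
  | nil => simp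
  | cons a w ih =>
    have e1 := h f p a (hw a List.mem_cons_self)
    have e2 := ih (p := p ++ [a]) fun x hx => by
      rw [List.count_append]; have := hw x (List.mem_cons_of_mem a hx); omega
    simpa [← mul_assoc, e1] using e2

/-- Since `m * a` and `m * ba` are left zeros, assigning `a` or `ba` to a fresh letter cuts off
everything after it. The two results together still determine the value `m` of the prefix. -/
theorem five_ext {m m' : FiveMonoid} (h1 : m * (S4.a : FiveMonoid) = m' * (S4.a : FiveMonoid))
    (h2 : m * (S4.ba : FiveMonoid) = m' * (S4.ba : FiveMonoid)) : m = m' := by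
  rcases m with _ | (_ | _ | _ | _) <;> rcases m' with _ | (_ | _ | _ | _) <;>
    first | rfl | (cases h1; done) | (cases h2; done)

theorem five_mul_a_mul (m n : FiveMonoid) :
    m * (S4.a : FiveMonoid) * n = m * (S4.a : FiveMonoid) := by
  rcases m with _ | (_ | _ | _ | _) <;> rcases n with _ | (_ | _ | _ | _) <;> rfl

theorem five_mul_ba_mul (m n : FiveMonoid) :
    m * (S4.ba : FiveMonoid) * n = m * (S4.ba : FiveMonoid) := by
  rcases m with _ | (_ | _ | _ | _) <;> rcases n with _ | (_ | _ | _ | _) <;> rfl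

theorem five_b_pow (n : ℕ) :
    (S4.b : FiveMonoid) ^ (n + 2) = (S4.bb : FiveMonoid) := by
  induction n with
  | zero => rfl
  | succ n ih => rw [pow_succ, ih]; rfl

theorem two_le_count_of_holds_five {u v : List ℕ} (h : Holds FiveMonoid u v) {x : ℕ}
    (hx : 2 ≤ u.count x) : 2 ≤ v.count x := by
  have e := h fun z => if z = x then (S4.b : FiveMonoid) else 1
  rw [prod_map_eq_pow _ x u (by intro z _ hz; simp [hz]),
    prod_map_eq_pow _ x v (by intro z _ hz; simp [hz])] at e
  obtain ⟨k, hk⟩ := Nat.exists_eq_add_of_le' hx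
  simp only [if_true] at e
  rw [hk, five_b_pow] at e
  by_contra hc
  have : v.count x = 0 ∨ v.count x = 1 := by omega
  rcases this with h0 | h0 <;> rw [h0] at e <;> cases e

theorem mem_of_holds_five {u v : List ℕ} (h : Holds FiveMonoid u v) {x : ℕ}
    (hx : x ∈ u) : x ∈ v := by
  by_contra hc
  have e := h fun z => if z = x then (S4.b : FiveMonoid) else 1
  rw [prod_map_eq_pow _ x u (by intro z _ hz; simp [hz]),
    prod_map_eq_pow _ x v (by intro z _ hz; simp [hz])] at e
  simp only [if_true] at e
  have hpos : 0 < u.count x := List.count_pos_iff.2 hx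
  rw [List.count_eq_zero.2 hc, pow_zero] at e
  have : u.count x = 1 ∨ ∃ k, u.count x = k + 2 := by
    rcases Nat.lt_or_ge (u.count x) 2 with h | h
    · left; omega
    · right; exact Nat.exists_eq_add_of_le' h
  rcases this with h0 | ⟨k, h0⟩ <;> rw [h0] at e
  · cases e
  · rw [five_b_pow] at e; cases e

theorem exists_last_new_letter {u : List ℕ} (hu : u ≠ []) :
    ∃ p y w, u = p ++ y :: w ∧ y ∉ p ∧ w ⊆ p ++ [y] := by
  induction u using List.reverseRecOn with
  | nil => exact absurd rfl hu
  | append_singleton u c ih =>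
    by_cases hc : c ∈ u
    · have hne : u ≠ [] := List.ne_nil_of_mem hc
      obtain ⟨p, y, w, rfl, hy, hw⟩ := ih hne
      refine ⟨p, y, w ++ [c], by simp, hy, ?_⟩
      intro z hz
      rcases List.mem_append.1 hz with hz | hz
      · exact hw hz
      · rw [List.mem_singleton.1 hz]
        simp only [List.mem_append, List.mem_cons, List.not_mem_nil, or_false] at hc ⊢
        rcases hc with hc | hc | hc
        · exact Or.inl hc
        · exact Or.inr hc
        · simpa using hw hc
    · exact ⟨u, c, [], rfl, hc, by simp⟩

/-- If `y` is fresh for `p` and `p'`, an identity `p y w ≈ p' y w'` of the five-element monoid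
restricts to `p ≈ p'`. -/
theorem holds_five_prefix {p p' w w' : List ℕ} {y : ℕ}
    (h : Holds FiveMonoid (p ++ y :: w) (p' ++ y :: w')) (hp : y ∉ p) (hp' : y ∉ p') :
    Holds FiveMonoid p p' := by
  intro f
  have key : ∀ (c : FiveMonoid) (q : List ℕ), y ∉ q →
      q.map (Function.update f y c) = q.map f := by
    intro c q hq
    apply List.map_congr_left
    intro z hz
    exact Function.update_of_ne (by rintro rfl; exact hq hz) _ _
  apply five_ext
  · have := h (Function.update f y (S4.a : FiveMonoid))
    simpa [key _ _ hp, key _ _ hp', ← mul_assoc, five_mul_a_mul] using this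
  · have := h (Function.update f y (S4.ba : FiveMonoid))
    simpa [key _ _ hp, key _ _ hp', ← mul_assoc, five_mul_ba_mul] using this

/-- The identities of the five-element monoid determine the order of first occurrences. -/
theorem mem_prefix_of_holds_five {p p' w w' : List ℕ} {y z : ℕ}
    (h : Holds FiveMonoid (p ++ y :: w) (p' ++ y :: w')) (hp : y ∉ p) (hp' : y ∉ p')
    (hz : z ∈ p) : z ∈ p' := by
  by_contra hc
  have hzy : z ≠ y := by rintro rfl; exact hp hz
  -- `a` and `ba` are distinct left zeros, so the value tells which of `z` and `y` occurs first.
  have e := h fun i => if i = z then (S4.a : FiveMonoid) else if i = y then S4.ba else 1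
  have e1 : (p'.map fun i => if i = z then (S4.a : FiveMonoid) else if i = y then S4.ba else 1) =
      p'.map fun _ => 1 := by
    apply List.map_congr_left
    intro i hi
    rw [if_neg, if_neg]
    · rintro rfl; exact hp' hi
    · rintro rfl; exact hc hi
  obtain ⟨q, r, rfl, hq⟩ := List.eq_append_cons_of_mem hz
  have e2 : (q.map fun i => if i = z then (S4.a : FiveMonoid) else if i = y then S4.ba else 1) =
      q.map fun _ => 1 := by
    apply List.map_congr_left
    intro i hi
    rw [if_neg, if_neg]
    · rintro rfl; exact hp (by simp [hi])
    · rintro rfl; exact hq hi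
  have e3 := five_mul_a_mul 1
  have e4 := five_mul_ba_mul 1
  simp only [one_mul] at e3 e4
  simp only [List.map_append, List.map_cons, List.prod_append, List.prod_cons, e1, e2,
    List.map_const', List.prod_replicate, one_pow, one_mul, if_true, if_neg hzy.symm, e3, e4] at e
  cases e

/-- Split `u` at the first occurrence of its last new letter `y`, so that the tail `w` uses only
letters already seen. The prefixes form a shorter identity, handled by induction, and `v` splits in
the same way. Each tail can be appended to the other side by absorption, because its letters occur
twice there, and after the prefix the two tails commute. -/
theorem holds_of_holds_five {M : Type u} [Monoid M]
    (h1 : ∀ x y : M, x * y * x = x * y * x ^ 2)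
    (h2 : ∀ x y : M, x ^ 2 * y ^ 2 = y ^ 2 * x ^ 2)
    (h3 : ∀ x y : M, x ^ 2 * y = x ^ 2 * y * x) {u v : List ℕ} (h : Holds FiveMonoid u v) :
    Holds M u v := by
  have habs := absorbs_two h1 h3
  induction hn : u.length using Nat.strong_induction_on generalizing u v with
  | _ n ih =>
  by_cases hu : u = []
  · subst hu
    have : v = [] := List.eq_nil_iff_forall_not_mem.2 fun x hx => by
      simpa using mem_of_holds_five h.symm hx
    subst this
    exact fun f => rfl
  obtain ⟨p, y, w, rfl, hy, hw⟩ := exists_last_new_letter hu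
  obtain ⟨p', w', rfl, hy'⟩ := List.eq_append_cons_of_mem
    (mem_of_holds_five h (x := y) (by simp))
  have hpp : Holds FiveMonoid p p' := holds_five_prefix h hy hy'
  have hpM : Holds M p p' := ih p.length (by subst hn; simp) hpp rfl
  have hsub : w ⊆ p' ++ [y] := by
    intro z hz
    have := hw hz
    simp only [List.mem_append, List.mem_singleton] at this ⊢
    exact this.imp_left (mem_of_holds_five hpp)
  have hsub' : w' ⊆ p' ++ [y] := by
    intro z hz
    simp only [List.mem_append, List.mem_singleton]
    by_cases hzy : z = y
    · exact Or.inr hzy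
    · have : z ∈ p ++ y :: w := mem_of_holds_five h.symm (by simp [hz])
      have hzp : z ∈ p := by
        simp only [List.mem_append, List.mem_cons, hzy, false_or] at this
        rcases this with h | h
        · exact h
        · simpa [hzy] using hw h
      exact Or.inl (mem_prefix_of_holds_five h hy hy' hzp)
  have h' : Holds FiveMonoid (p' ++ [y] ++ w) (p' ++ [y] ++ w') := by
    intro f
    have e1 := hpp f
    have e2 := h f
    simp only [List.map_append, List.map_cons, List.map_nil, List.prod_append, List.prod_cons,
      List.prod_nil, mul_one, mul_assoc] at e1 e2 ⊢
    rw [← e2, e1]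
  -- A letter of `b` occurs both in `q` and in `b`, and being repeated is an invariant of the
  -- identity.
  have key : ∀ {q a b : List ℕ}, Holds FiveMonoid (q ++ a) (q ++ b) → b ⊆ q → ∀ x ∈ b,
      2 ≤ (q ++ a).count x := by
    intro q a b hab hb x hx
    apply two_le_count_of_holds_five hab.symm
    rw [List.count_append]
    have := List.count_pos_iff.2 hx
    have := List.count_pos_iff.2 (hb hx)
    omega
  intro f
  calc ((p ++ y :: w).map f).prod = ((p' ++ [y] ++ w).map f).prod := by
        simp [hpM f]
    _ = ((p' ++ [y] ++ w ++ w').map f).prod := (habs.prod_append_eq f (key h' hsub')).symm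
    _ = ((p' ++ [y] ++ w' ++ w).map f).prod := prod_append_comm h1 h2 f hsub hsub'
    _ = ((p' ++ [y] ++ w').map f).prod := habs.prod_append_eq f (key h'.symm hsub)
    _ = ((p' ++ y :: w').map f).prod := by simp

theorem varietyK_le : varietyK.{u} ≤ Variety.generatedBy (ULift.{u} FiveMonoid) := by
  refine Variety.le_generatedBy_iff.2 fun N _ hN u v huv => ?_
  have law : ∀ p ∈ identitiesK, ∀ g : ℕ → N,
      FreeMonoid.lift g p.1 = FreeMonoid.lift g p.2 := fun p hp g => hN p hp (FreeMonoid.lift g)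
  refine holds_of_holds_five (fun x y => ?_) (fun x y => ?_) (fun x y => ?_) huv
  · simpa [letter] using law _ (Or.inl rfl)
      (fun i => if i = 0 then x else y)
  · simpa [letter] using law _ (Or.inr (Or.inl rfl))
      (fun i => if i = 0 then x else y)
  · simpa [letter] using law _ (Or.inr (Or.inr rfl))
      (fun i => if i = 0 then x else y)

end FiveMonoid

end MonoidVar

/-! ### The variety `D` and the Brandt monoid. -/

namespace MonoidVar

section BrandtMonoid

/-- The laws that define the variety `D`, for the elements of a single monoid. -/
structure DLaws (M : Type u) [Monoid M] : Prop where
  sq : ∀ x : M, x ^ 2 = x ^ 3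
  central : ∀ x y : M, x ^ 2 * y = y * x ^ 2
  sigma₁ : ∀ x y z t : M, x * y * z * x * t * y = y * x * z * x * t * y
  sigma₂ : ∀ x y z t : M, x * t * y * z * x * y = x * t * y * z * y * x
  gamma : ∀ x y z t : M, y * z * x * y * t * x = y * z * y * x * t * x

/-- The law to apply depends on where other copies of `x` and `y` stand: `sigma₂` if both lie to the
left, `sigma₁` if both lie to the right, `gamma` if they lie on different sides. -/
theorem DLaws.prod_swap {M : Type u} [Monoid M] (h : DLaws M) (f : ℕ → M) {p q : List ℕ}
    {x y : ℕ} (hx : 2 ≤ (p ++ x :: y :: q).count x) (hy : 2 ≤ (p ++ x :: y :: q).count y) :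
    ((p ++ x :: y :: q).map f).prod = ((p ++ y :: x :: q).map f).prod := by
  by_cases hxy : x = y
  · rw [hxy]
  have mx : x ∈ p ∨ x ∈ q := by
    by_contra hc
    push Not at hc
    simp [List.count_eq_zero.2 hc.1, List.count_eq_zero.2 hc.2, Ne.symm hxy] at hx
  have my : y ∈ p ∨ y ∈ q := by
    by_contra hc
    push Not at hc
    simp [List.count_eq_zero.2 hc.1, List.count_eq_zero.2 hc.2, hxy] at hy
  have two : ∀ l : List ℕ, x ∈ l → y ∈ l →
      (∃ a b c, l = a ++ x :: (b ++ y :: c)) ∨ ∃ a b c, l = a ++ y :: (b ++ x :: c) := by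
    intro l hx hy
    obtain ⟨a, s, rfl⟩ := List.append_of_mem hx
    simp only [List.mem_append, List.mem_cons, Ne.symm hxy, false_or] at hy
    rcases hy with hy | hy
    · obtain ⟨b, c, rfl⟩ := List.append_of_mem hy
      exact Or.inr ⟨b, c, s, by simp⟩
    · obtain ⟨b, c, rfl⟩ := List.append_of_mem hy
      exact Or.inl ⟨a, b, c, rfl⟩
  rcases mx with mx | mx <;> rcases my with my | my
  · rcases two p mx my with ⟨a, b, c, rfl⟩ | ⟨a, b, c, rfl⟩
    · have e := h.sigma₂ (f x) (f y) (c.map f).prod (b.map f).prod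
      have := congrArg (fun w => (a.map f).prod * w * (q.map f).prod) e
      simpa [mul_assoc] using this
    · have e := h.sigma₂ (f y) (f x) (c.map f).prod (b.map f).prod
      have := congrArg (fun w => (a.map f).prod * w * (q.map f).prod) e.symm
      simpa [mul_assoc] using this
  · obtain ⟨a, b, rfl⟩ := List.append_of_mem mx
    obtain ⟨c, d, rfl⟩ := List.append_of_mem my
    have e := h.gamma (f y) (f x) (b.map f).prod (c.map f).prod
    have := congrArg (fun w => (a.map f).prod * w * (d.map f).prod) e.symm
    simpa [mul_assoc] using this
  · obtain ⟨a, b, rfl⟩ := List.append_of_mem my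
    obtain ⟨c, d, rfl⟩ := List.append_of_mem mx
    have e := h.gamma (f x) (f y) (b.map f).prod (c.map f).prod
    have := congrArg (fun w => (a.map f).prod * w * (d.map f).prod) e
    simpa [mul_assoc] using this
  · rcases two q mx my with ⟨a, b, c, rfl⟩ | ⟨a, b, c, rfl⟩
    · have e := h.sigma₁ (f x) (f y) (a.map f).prod (b.map f).prod
      have := congrArg (fun w => (p.map f).prod * w * (c.map f).prod) e
      simpa [mul_assoc] using this
    · have e := h.sigma₁ (f y) (f x) (a.map f).prod (b.map f).prod
      have := congrArg (fun w => (p.map f).prod * w * (c.map f).prod) e.symm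
      simpa [mul_assoc] using this

theorem DLaws.prod_move {M : Type u} [Monoid M] (h : DLaws M) (f : ℕ → M) {r p s : List ℕ}
    {x : ℕ} (hr : ∀ y ∈ r, 2 ≤ (p ++ (r ++ x :: s)).count y)
    (hx : r ≠ [] → 2 ≤ (p ++ (r ++ x :: s)).count x) :
    ((p ++ (r ++ x :: s)).map f).prod = ((p ++ x :: (r ++ s)).map f).prod := by
  induction r generalizing p with
  | nil => rfl
  | cons y r ih =>
    have hx := hx (by simp)
    have e1 := ih (p := p ++ [y]) (fun z hz => by
      have := hr z (List.mem_cons_of_mem _ hz); simpa using this)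
      (fun _ => by simpa using hx)
    have perm : (p ++ y :: x :: (r ++ s)).Perm (p ++ (y :: r ++ x :: s)) := by
      apply List.Perm.append_left
      exact List.Perm.cons _ List.perm_middle.symm
    have e2 := h.prod_swap f (p := p) (q := r ++ s) (x := y) (y := x)
      (by rw [perm.count_eq]; exact hr y List.mem_cons_self) (by rw [perm.count_eq]; exact hx)
    simp only [List.append_assoc, List.cons_append, List.nil_append] at e1 e2 ⊢
    rw [e1, e2]

theorem DLaws.sq_mul_prod {M : Type u} [Monoid M] (h : DLaws M) (f : ℕ → M) (x : ℕ)
    (l : List ℕ) :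
    f x ^ 2 * (l.map f).prod = f x ^ 2 * ((l.filter (· ≠ x)).map f).prod := by
  induction l with
  | nil => rfl
  | cons a l ih =>
    by_cases ha : a = x
    · subst ha
      rw [List.map_cons, List.prod_cons, ← mul_assoc, ← pow_succ, ← h.sq, ih]
      simp
    · rw [List.map_cons, List.prod_cons, ← mul_assoc, h.central, mul_assoc, ih, ← mul_assoc,
        ← h.central]
      simp [ha, mul_assoc]

/-- Only repeated letters separate the two copies of `x`, so the copies can be brought together.
Their square is central and swallows every other `x`. -/
theorem DLaws.prod_extract {M : Type u} [Monoid M] (h : DLaws M) (f : ℕ → M) {p r q : List ℕ}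
    {x : ℕ} (hr : ∀ y ∈ r, 2 ≤ (p ++ x :: (r ++ x :: q)).count y) :
    ((p ++ x :: (r ++ x :: q)).map f).prod =
      f x ^ 2 * (((p ++ x :: (r ++ x :: q)).filter (· ≠ x)).map f).prod := by
  have e1 := h.prod_move f (p := p ++ [x]) (r := r) (x := x) (s := q)
    (fun y hy => by simpa using hr y hy) (fun _ => by simp; omega)
  have e3 : ((p ++ x :: (r ++ x :: q)).filter (· ≠ x)) = (p ++ (r ++ q)).filter (· ≠ x) := by
    simp
  rw [e3, ← h.sq_mul_prod f x]
  simp only [List.append_assoc, List.cons_append, List.nil_append] at e1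
  rw [e1]
  simp only [List.map_append, List.map_cons, List.prod_append, List.prod_cons]
  rw [← mul_assoc (f x ^ 2), h.central, pow_two]
  simp only [mul_assoc]

/-- Words that agree after restriction to the linear letters and any one further letter have equal
values in every monoid of `D`. -/
theorem DLaws.prod_eq_of_filter_eq {M : Type u} [Monoid M] (h : DLaws M) (f : ℕ → M)
    (lin : ℕ → Bool) {u p v : List ℕ}
    (hrep : ∀ y ∈ u, lin y = false → 2 ≤ (p ++ u).count y)
    (hf : ∀ x, u.filter (fun z => z = x || lin z) = v.filter (fun z => z = x || lin z)) :
    ((p ++ u).map f).prod = ((p ++ v).map f).prod := by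
  induction u generalizing p v with
  | nil =>
    cases v with
    | nil => rfl
    | cons b v => simpa using hf b
  | cons x u ih =>
    have hcount : ∀ z, (x :: u).count z = v.count z := by
      intro z
      have := congrArg (List.count z) (hf z)
      rwa [List.count_filter (by simp), List.count_filter (by simp)] at this
    have hxv : x ∈ v := by
      rw [← List.count_pos_iff, ← hcount]; simp
    obtain ⟨r, s, rfl, hxr⟩ := List.eq_append_cons_of_mem hxv
    -- In a restriction that retains `x`, the left word starts with `x`; a retained letter of `r`
    -- would make the right word start differently. Hence `r` has no linear letter, and `r` is empty
    -- if `x` is linear.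
    have key : ∀ z, (z = x ∨ lin x = true) → ∀ y ∈ r, ¬(y = z ∨ lin y = true) := by
      intro z hz y hy hyz
      have e := hf z
      have hz' : (x = z || lin x) = true := by rcases hz with rfl | hz <;> simp [*]
      have fpos : ∀ l : List ℕ, (x :: l).filter (fun w => w = z || lin w) =
          x :: l.filter (fun w => w = z || lin w) := fun l => List.filter_cons_of_pos hz'
      rw [List.filter_append, fpos, fpos] at e
      have hmem : y ∈ r.filter (fun w => w = z || lin w) := by simp [hy, hyz]
      cases hc : r.filter (fun w => w = z || lin w) with
      | nil => rw [hc] at hmem; simp at hmem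
      | cons c t =>
        rw [hc, List.cons_append, List.cons_eq_cons] at e
        have : c ∈ r.filter (fun w => w = z || lin w) := by rw [hc]; simp
        exact hxr (e.1 ▸ List.mem_of_mem_filter this)
    have hlin : ∀ y ∈ r, lin y = false := fun y hy => by
      simpa using fun hl => key x (Or.inl rfl) y hy (Or.inr hl)
    have hxlin : r ≠ [] → lin x = false := by
      intro hr
      obtain ⟨y, hy⟩ := List.exists_mem_of_ne_nil r hr
      by_contra hc
      exact key y (Or.inr (by simpa using hc)) y hy (Or.inl rfl)
    have hperm : ∀ z, (p ++ (r ++ x :: s)).count z = (p ++ x :: u).count z := fun z => by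
      have := hcount z
      simp only [List.count_append] at this ⊢
      omega
    have hmem : ∀ y ∈ r, y ∈ x :: u := fun y hy => by
      rw [← List.count_pos_iff, hcount, List.count_pos_iff]; simp [hy]
    rw [h.prod_move f (p := p) (r := r) (x := x) (s := s)
      (fun y hy => by rw [hperm]; exact hrep y (hmem y hy) (hlin y hy))
      (fun hr => by rw [hperm]; exact hrep x List.mem_cons_self (hxlin hr))]
    have := ih (p := p ++ [x]) (v := r ++ s)
      (fun y hy hl => by simpa using hrep y (List.mem_cons_of_mem _ hy) hl) (fun z => by
        have e := hf z
        by_cases hz : z = x ∨ lin x = true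
        · have hz' : (x = z || lin x) = true := by rcases hz with rfl | hz <;> simp [*]
          have fpos : ∀ l : List ℕ, (x :: l).filter (fun w => w = z || lin w) =
              x :: l.filter (fun w => w = z || lin w) := fun l => List.filter_cons_of_pos hz'
          have hr : r.filter (fun w => w = z || lin w) = [] := by
            rw [List.filter_eq_nil_iff]
            intro y hy
            simpa using key z hz y hy
          rw [List.filter_append, hr, List.nil_append, fpos, fpos] at e
          rw [List.filter_append, hr, List.nil_append]
          exact (List.cons_eq_cons.1 e).2
        · have hz' : ¬(x = z || lin x) = true := fun hc => hz (by
            simpa [eq_comm (a := z)] using hc)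
          have fneg : ∀ l : List ℕ, (x :: l).filter (fun w => w = z || lin w) =
              l.filter (fun w => w = z || lin w) := fun l => List.filter_cons_of_neg hz'
          rwa [List.filter_append, fneg, fneg, ← List.filter_append] at e)
    simpa using this

instance finite_brandtMonoid : Finite BrandtMonoid := by
  have : Finite B2 := Finite.of_surjective ![B2.a, B2.b, B2.ab, B2.ba, B2.zero] (by
    intro x
    cases x
    exacts [⟨0, rfl⟩, ⟨1, rfl⟩, ⟨2, rfl⟩, ⟨3, rfl⟩, ⟨4, rfl⟩])
  exact inferInstanceAs (Finite (Option B2))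

theorem brandt_zero_mul (m : BrandtMonoid) :
    (B2.zero : BrandtMonoid) * m = (B2.zero : BrandtMonoid) := by
  rcases m with _ | (_ | _ | _ | _ | _) <;> rfl

theorem brandt_ba_mul_ne_a (m : BrandtMonoid) :
    (B2.ba : BrandtMonoid) * m ≠ (B2.a : BrandtMonoid) := by
  intro h
  rcases m with _ | (_ | _ | _ | _ | _) <;> cases h

theorem brandt_a_pow (n : ℕ) :
    (B2.a : BrandtMonoid) ^ (n + 2) = (B2.zero : BrandtMonoid) := by
  induction n with
  | zero => rfl
  | succ n ih => rw [pow_succ, ih]; rfl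

theorem brandt_a_mul_ba_pow (n : ℕ) :
    (B2.a : BrandtMonoid) * (B2.ba : BrandtMonoid) ^ n = (B2.a : BrandtMonoid) := by
  induction n with
  | zero => rfl
  | succ n ih => rw [pow_succ, ← mul_assoc, ih]; rfl

theorem count_eq_one_of_holds_brandt {u v : List ℕ} (h : Holds BrandtMonoid u v) {x : ℕ}
    (hx : u.count x = 1) : v.count x = 1 := by
  have e := h fun z => if z = x then (B2.a : BrandtMonoid) else 1
  rw [prod_map_eq_pow _ x u (by intro z _ hz; simp [hz]),
    prod_map_eq_pow _ x v (by intro z _ hz; simp [hz])] at e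
  simp only [if_true, hx] at e
  by_contra hc
  have : v.count x = 0 ∨ ∃ k, v.count x = k + 2 := by
    rcases Nat.lt_or_ge (v.count x) 2 with h | h
    · left; omega
    · right; exact Nat.exists_eq_add_of_le' h
  rcases this with h0 | ⟨k, h0⟩ <;> rw [h0] at e
  · cases e
  · rw [brandt_a_pow] at e; cases e

/-- Words without repeated letters that agree in the Brandt monoid are equal. -/
theorem eq_of_holds_brandt_of_nodup {u v : List ℕ} (h : Holds BrandtMonoid u v)
    (hu : u.Nodup) (hv : v.Nodup) : u = v := by
  induction u generalizing v with
  | nil =>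
    cases v with
    | nil => rfl
    | cons b v =>
      have := count_eq_one_of_holds_brandt h.symm
        (List.count_eq_one_of_mem hv List.mem_cons_self)
      simp at this
  | cons a u ih =>
    cases v with
    | nil =>
      have := count_eq_one_of_holds_brandt h
        (List.count_eq_one_of_mem hu List.mem_cons_self)
      simp at this
    | cons b v =>
      by_cases hab : a = b
      · subst hab
        have e := h.filter (· ≠ a)
        have hu' := (List.nodup_cons.1 hu).1
        have hv' := (List.nodup_cons.1 hv).1
        have fu : ∀ l : List ℕ, a ∉ l → (a :: l).filter (· ≠ a) = l := by
          intro l hl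
          rw [List.filter_cons_of_neg (by simp), List.filter_eq_self]
          intro z hz
          simpa using fun hza : z = a => hl (hza ▸ hz)
        rw [fu u hu', fu v hv'] at e
        rw [ih e (List.nodup_cons.1 hu).2 (List.nodup_cons.1 hv).2]
      · exfalso
        -- The word starting with the letter `a` takes the value `a · (ba)^k = a`; the other starts
        -- with `ba`, and no right multiple of `ba` is `a`.
        have e := h fun z => if z = a then (B2.a : BrandtMonoid) else
          if z = b then (B2.ba : BrandtMonoid) else 1
        have hu' := (List.nodup_cons.1 hu).1
        rw [List.map_cons, List.map_cons, List.prod_cons, List.prod_cons,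
          prod_map_eq_pow _ b u (by
            intro z hz hzb
            have : z ≠ a := fun hza => hu' (hza ▸ hz)
            simp [this, hzb])] at e
        simp only [if_true, if_neg (Ne.symm hab), brandt_a_mul_ba_pow] at e
        exact brandt_ba_mul_ne_a _ e.symm

/-- The labelling `f` marks those letters of `l` that are directly followed by `x`. -/
def IsLabelling (x : ℕ) (f : ℕ → BrandtMonoid) (l : List ℕ) : Prop :=
  f x = (B2.a : BrandtMonoid) ∧ ∀ p t q, l = p ++ t :: q → t ≠ x →
    f t = if q.head? = some x then (B2.b : BrandtMonoid) else (B2.ba : BrandtMonoid)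

theorem IsLabelling.tail {x t : ℕ} {f : ℕ → BrandtMonoid} {l : List ℕ}
    (h : IsLabelling x f (t :: l)) : IsLabelling x f l :=
  ⟨h.1, fun p s q hl hs => h.2 (t :: p) s q (by simp [hl]) hs⟩

theorem IsLabelling.apply {x : ℕ} {f : ℕ → BrandtMonoid} {l : List ℕ}
    (h : IsLabelling x f l) {t : ℕ} (ht : t ∈ l) (htx : t ≠ x) :
    f t = (B2.b : BrandtMonoid) ∨ f t = (B2.ba : BrandtMonoid) := by
  obtain ⟨p, q, rfl⟩ := List.append_of_mem ht
  rw [h.2 p t q rfl htx]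
  split_ifs <;> simp

theorem exists_isLabelling (x : ℕ) {l : List ℕ} (hl : (l.filter (· ≠ x)).Nodup) :
    ∃ f, IsLabelling x f l := by
  induction l with
  | nil => exact ⟨fun _ => (B2.a : BrandtMonoid), rfl, by simp⟩
  | cons t l ih =>
    by_cases htx : t = x
    · subst htx
      obtain ⟨f, h1, h2⟩ := ih (by simpa using hl)
      refine ⟨f, h1, fun p s q hp hs => ?_⟩
      cases p with
      | nil => exact absurd (List.cons_eq_cons.1 hp).1.symm hs
      | cons c p => exact h2 p s q (List.cons_eq_cons.1 hp).2 hs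
    · rw [List.filter_cons_of_pos (by simpa using htx), List.nodup_cons] at hl
      obtain ⟨f, h1, h2⟩ := ih hl.2
      refine ⟨Function.update f t (if l.head? = some x then (B2.b : BrandtMonoid)
        else (B2.ba : BrandtMonoid)), ?_, fun p s q hp hs => ?_⟩
      · rw [Function.update_of_ne (Ne.symm htx), h1]
      · cases p with
        | nil =>
          obtain ⟨rfl, rfl⟩ := List.cons_eq_cons.1 hp
          simp
        | cons c p =>
          have hp' := (List.cons_eq_cons.1 hp).2
          rw [Function.update_of_ne, h2 p s q hp' hs]
          rintro rfl
          exact hl.1 (by simp [hp', hs])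

/-- Left factors act as the states of an automaton. In state `ba` the letter `x` is forbidden; a
letter labelled `ba` keeps the state, and one labelled `b` leads to state `b`, where reading `x`
returns to `ba`. -/
theorem IsLabelling.ba_mul_prod {x : ℕ} {f : ℕ → BrandtMonoid} {l : List ℕ}
    (h : IsLabelling x f l) (hx : l.head? ≠ some x) (hxx : ¬ [x, x] <:+: l) :
    (B2.ba : BrandtMonoid) * (l.map f).prod = (B2.ba : BrandtMonoid) := by
  induction hn : l.length using Nat.strong_induction_on generalizing l with
  | _ n ih =>
  cases l with
  | nil => rfl
  | cons t l =>
    have htx : t ≠ x := by simpa using hx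
    have ht := h.2 [] t l rfl htx
    have hsub : ∀ {m : List ℕ}, m <:+ t :: l → ¬ [x, x] <:+: m := fun hm hc =>
      hxx (hc.trans hm.isInfix)
    by_cases hl : l.head? = some x
    · obtain ⟨l, rfl⟩ := List.head?_eq_some_iff.1 hl
      rw [if_pos hl] at ht
      have := ih l.length (by subst hn; simp) h.tail.tail (by
        intro hc
        obtain ⟨m, rfl⟩ := List.head?_eq_some_iff.1 hc
        exact hxx ⟨[t], m, by simp⟩) (hsub ⟨[t, x], by simp⟩) rfl
      rw [List.map_cons, List.map_cons, List.prod_cons, List.prod_cons, ht, h.1, ← mul_assoc,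
        ← mul_assoc]
      exact this
    · rw [if_neg hl] at ht
      have := ih l.length (by subst hn; simp) h.tail hl (hsub ⟨[t], by simp⟩) rfl
      rw [List.map_cons, List.prod_cons, ht, ← mul_assoc]
      exact this

/-- A misplaced or missing `x` in `k` sends the automaton to zero or leaves it in state `b`. With
the other letters in the same order, ending in state `ba` forces every `x` into its place in `l`. -/
theorem IsLabelling.eq_of_ba_mul_prod {x : ℕ} {f : ℕ → BrandtMonoid} {l k : List ℕ}
    (h : IsLabelling x f l) (hx : l.head? ≠ some x) (hxx : ¬ [x, x] <:+: l)
    (hlk : l.filter (· ≠ x) = k.filter (· ≠ x))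
    (hk : (B2.ba : BrandtMonoid) * (k.map f).prod = (B2.ba : BrandtMonoid)) : k = l := by
  induction hn : l.length using Nat.strong_induction_on generalizing l k with
  | _ n ih =>
  have hkx : ∀ m, k ≠ x :: m := by
    rintro m rfl
    rw [List.map_cons, List.prod_cons, h.1, ← mul_assoc] at hk
    have hk : (B2.zero : BrandtMonoid) * _ = _ := hk
    rw [brandt_zero_mul] at hk
    cases hk
  have cons_eq : ∀ {t s : ℕ} {l m : List ℕ}, t ≠ x → s ≠ x →
      (t :: l).filter (· ≠ x) = (s :: m).filter (· ≠ x) →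
      t = s ∧ l.filter (· ≠ x) = m.filter (· ≠ x) := by
    intro t s l m ht hs e
    rwa [List.filter_cons_of_pos (by simpa using ht), List.filter_cons_of_pos (by simpa using hs),
      List.cons_eq_cons] at e
  cases k with
  | nil =>
    cases l with
    | nil => rfl
    | cons t l =>
      have htx : t ≠ x := by simpa using hx
      simp [htx] at hlk
  | cons s k =>
  have hsx : s ≠ x := fun e => hkx k (by rw [e])
  cases l with
  | nil => simp [hsx] at hlk
  | cons t l =>
    have htx : t ≠ x := by simpa using hx
    obtain ⟨rfl, htl⟩ := cons_eq htx hsx hlk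
    have ht := h.2 [] t l rfl htx
    have hsub : ∀ {m : List ℕ}, m <:+ t :: l → ¬ [x, x] <:+: m := fun hm hc =>
      hxx (hc.trans hm.isInfix)
    rw [List.map_cons, List.prod_cons, ht] at hk
    by_cases hl : l.head? = some x
    · obtain ⟨l, rfl⟩ := List.head?_eq_some_iff.1 hl
      rw [if_pos hl, ← mul_assoc] at hk
      have hk : (B2.b : BrandtMonoid) * _ = _ := hk
      cases k with
      | nil => cases hk
      | cons c k =>
        by_cases hc : c = x
        · subst hc
          rw [List.map_cons, List.prod_cons, h.1, ← mul_assoc] at hk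
          have := ih l.length (by subst hn; simp) h.tail.tail (by
            intro hc
            obtain ⟨m, rfl⟩ := List.head?_eq_some_iff.1 hc
            exact hxx ⟨[t], m, by simp⟩) (hsub ⟨[t, c], by simp⟩) (by simpa using htl) hk rfl
          rw [this]
        · exfalso
          have hcl : c ∈ t :: x :: l := by
            have : c ∈ (x :: l).filter (· ≠ x) := by rw [htl]; simp [hc]
            exact List.mem_cons_of_mem _ (List.mem_of_mem_filter this)
          rw [List.map_cons, List.prod_cons, ← mul_assoc] at hk
          rcases h.apply hcl hc with e | e <;> rw [e] at hk <;>
            · have hk : (B2.zero : BrandtMonoid) * _ = _ := hk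
              rw [brandt_zero_mul] at hk
              cases hk
    · rw [if_neg hl, ← mul_assoc] at hk
      rw [ih l.length (by subst hn; simp) h.tail hl (hsub ⟨[t], by simp⟩) htl hk rfl]

/-- The identities of the Brandt monoid determine the position of a letter `x` among linear
letters unless two occurrences of `x` become adjacent. -/
theorem eq_of_holds_brandt_of_not_infix {x : ℕ} {l k : List ℕ} (h : Holds BrandtMonoid l k)
    (hl : (l.filter (· ≠ x)).Nodup) (hk : (k.filter (· ≠ x)).Nodup)
    (hxx : ¬ [x, x] <:+: l) : l = k := by
  have hlk := eq_of_holds_brandt_of_nodup (h.filter (· ≠ x)) hl hk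
  obtain ⟨f, hf⟩ := exists_isLabelling x hl
  have e := h f
  by_cases hx : l.head? = some x
  · obtain ⟨l, rfl⟩ := List.head?_eq_some_iff.1 hx
    have hx' : l.head? ≠ some x := by
      intro hc
      obtain ⟨m, rfl⟩ := List.head?_eq_some_iff.1 hc
      exact hxx ⟨[], m, by simp⟩
    have hxx' : ¬ [x, x] <:+: l := fun hc => hxx (hc.trans (List.suffix_cons x l).isInfix)
    have e1 := hf.tail.ba_mul_prod hx' hxx'
    -- Multiplying by `b` turns the leading `x` into `ba`, the initial state of the automaton.
    have e2 := congrArg ((B2.b : BrandtMonoid) * ·) e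
    simp only [List.map_cons, List.prod_cons, hf.1, ← mul_assoc] at e2
    have e3 : (B2.b : BrandtMonoid) * (B2.a : BrandtMonoid) = (B2.ba : BrandtMonoid) := rfl
    rw [e3, e1] at e2
    cases k with
    | nil => cases e2
    | cons c k =>
      by_cases hc : c = x
      · subst hc
        rw [List.map_cons, List.prod_cons, hf.1, ← mul_assoc] at e2
        rw [hf.tail.eq_of_ba_mul_prod hx' hxx' (by simpa using hlk) e2.symm]
      · exfalso
        have hcl : c ∈ x :: l := by
          have : c ∈ (x :: l).filter (· ≠ x) := by rw [hlk]; simp [hc]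
          exact List.mem_of_mem_filter this
        rw [List.map_cons, List.prod_cons, ← mul_assoc] at e2
        rcases hf.apply hcl hc with e | e <;> rw [e] at e2 <;>
          · have hk : _ = (B2.zero : BrandtMonoid) * _ := e2
            rw [brandt_zero_mul] at hk
            cases hk
  · have e1 := hf.ba_mul_prod hx hxx
    rw [e] at e1
    exact (hf.eq_of_ba_mul_prod hx hxx hlk e1).symm

/-- Restrict to the linear letters and one letter `x`. If `xx` appears for some `x`, it appears on
both sides, so a central `x²` is extracted from each and induction applies to the words without `x`.
Otherwise all these restrictions coincide and `DLaws.prod_eq_of_filter_eq` finishes. -/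
theorem holds_of_holds_brandt {M : Type u} [Monoid M] (h : DLaws M) {u v : List ℕ}
    (huv : Holds BrandtMonoid u v) : Holds M u v := by
  induction hn : u.length using Nat.strong_induction_on generalizing u v with
  | _ n ih =>
  have hlin : ∀ z, (u.count z == 1) = (v.count z == 1) := by
    intro z
    rw [Bool.eq_iff_iff, beq_iff_eq, beq_iff_eq]
    exact ⟨count_eq_one_of_holds_brandt huv, count_eq_one_of_holds_brandt huv.symm⟩
  have hnodup : ∀ (w : List ℕ) (x : ℕ),
      ((w.filter fun z => z = x || w.count z == 1).filter (· ≠ x)).Nodup := by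
    intro w x
    rw [List.nodup_iff_count_le_one]
    intro y
    by_contra hc
    have hy : y ∈ (w.filter fun z => z = x || w.count z == 1).filter (· ≠ x) :=
      List.count_pos_iff.1 (by omega)
    simp only [List.mem_filter, decide_eq_true_eq, Bool.or_eq_true, beq_iff_eq] at hy
    have h1 := hy.1.2.resolve_left hy.2
    rw [List.filter_filter] at hc
    have h2 : (w.filter _).count y ≤ w.count y :=
      (List.filter_sublist (p := fun a => decide (a ≠ x) && (decide (a = x) ||
        List.count a w == 1)) (l := w)).count_le y
    omega
  have hstar : ∀ x, Holds BrandtMonoid (u.filter fun z => z = x || u.count z == 1)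
      (v.filter fun z => z = x || v.count z == 1) := by
    intro x
    simp only [← hlin]
    exact huv.filter _
  have hextract : ∀ (w : List ℕ) (x : ℕ) (f : ℕ → M),
      [x, x] <:+: (w.filter fun z => z = x || w.count z == 1) → x ∈ w ∧
      (w.map f).prod = f x ^ 2 * ((w.filter (· ≠ x)).map f).prod := by
    rintro w x f ⟨c, d, hcd⟩
    rw [List.append_assoc] at hcd
    obtain ⟨p, s, rfl, -, hs⟩ := List.filter_eq_append_iff.1 hcd.symm
    obtain ⟨p', s', rfl, -, -, hs'⟩ := List.filter_eq_cons_iff.1 hs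
    obtain ⟨r, q, rfl, hr, -, -⟩ := List.filter_eq_cons_iff.1 hs'
    refine ⟨by simp, ?_⟩
    have := h.prod_extract f (p := p ++ p') (r := r) (q := q) (x := x) (fun y hy => by
      have h1 := hr y hy
      have h2 : 0 < (p ++ (p' ++ x :: (r ++ x :: q))).count y := by
        rw [List.count_pos_iff]; simp [hy]
      simp only [Bool.or_eq_true, decide_eq_true_eq, beq_iff_eq, not_or] at h1
      rw [List.append_assoc]
      omega)
    rwa [List.append_assoc] at this
  intro f
  by_cases hred : ∃ x, [x, x] <:+: (u.filter fun z => z = x || u.count z == 1)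
  · obtain ⟨x, hx⟩ := hred
    have hx' : [x, x] <:+: (v.filter fun z => z = x || v.count z == 1) := by
      by_contra hc
      have := eq_of_holds_brandt_of_not_infix (hstar x).symm (hnodup v x) (hnodup u x) hc
      rw [this] at hc
      exact hc hx
    obtain ⟨hxu, e1⟩ := hextract u x f hx
    obtain ⟨-, e2⟩ := hextract v x f hx'
    have hlt : (u.filter (· ≠ x)).length < n := by
      subst hn
      apply lt_of_le_of_ne (List.length_filter_le _ _)
      intro hc
      rw [List.length_filter_eq_length_iff] at hc
      simpa using hc x hxu
    rw [e1, e2, ih _ hlt (huv.filter (· ≠ x)) rfl f]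
  · push Not at hred
    have key := h.prod_eq_of_filter_eq f (fun z => u.count z == 1) (u := u) (p := []) (v := v)
      (fun y hy hl => by
        have := List.count_pos_iff.2 hy
        simp only [beq_eq_false_iff_ne] at hl
        simp only [List.nil_append]
        omega) (fun x => by
          have := eq_of_holds_brandt_of_not_infix (hstar x) (hnodup u x) (hnodup v x) (hred x)
          rw [this]
          simp only [hlin])
    simpa using key

theorem varietyD_contains_iff {M : Type u} [Monoid M] : varietyD.Contains M ↔ DLaws M := by
  constructor
  · intro hM
    have law : ∀ p ∈ identitiesD, ∀ g : ℕ → M,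
        FreeMonoid.lift g p.1 = FreeMonoid.lift g p.2 :=
      fun p hp g => hM p hp (FreeMonoid.lift g)
    refine ⟨fun x => ?_, fun x y => ?_, fun x y z t => ?_, fun x y z t => ?_,
      fun x y z t => ?_⟩
    · simpa [letter] using law _ (Or.inl rfl) (fun _ => x)
    · simpa [letter] using law _ (Or.inr (Or.inl rfl)) (fun i => if i = 0 then x else y)
    · simpa [letter] using law _ (Or.inr (Or.inr (Or.inl rfl)))
        (fun i => if i = 0 then x else if i = 1 then y else if i = 2 then z else t)
    · simpa [letter] using law _ (Or.inr (Or.inr (Or.inr (Or.inl rfl))))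
        (fun i => if i = 0 then x else if i = 1 then y else if i = 2 then z else t)
    · simpa [letter] using law _ (Or.inr (Or.inr (Or.inr (Or.inr rfl))))
        (fun i => if i = 0 then t else if i = 1 then x else if i = 2 then z else y)
  · intro h p hp φ
    rcases hp with rfl | rfl | rfl | rfl | rfl <;> simp only [map_mul, map_pow]
    · exact h.sq _
    · exact h.central _ _
    · exact h.sigma₁ _ _ _ _
    · exact h.sigma₂ _ _ _ _
    · exact h.gamma _ _ _ _

theorem varietyD_le : varietyD.{u} ≤ Variety.generatedBy (ULift.{u} BrandtMonoid) :=
  Variety.le_generatedBy_iff.2 fun _ _ hN _ _ huv =>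
    holds_of_holds_brandt (varietyD_contains_iff.1 hN) huv

end BrandtMonoid

end MonoidVar

/-! ### Factor monoids, isoterms and aperiodicity. -/

namespace MonoidVar

section FactorMonoid

/-- The congruence on words that identifies all words that are not factors of `w`. -/
def factorCon (w : List ℕ) : Con (FreeMonoid ℕ) where
  r u v := u = v ∨ ¬ u.toList <:+: w ∧ ¬ v.toList <:+: w
  iseqv := by
    refine ⟨fun _ => Or.inl rfl, ?_, ?_⟩
    · rintro u v (rfl | h)
      exacts [Or.inl rfl, Or.inr h.symm]
    · rintro u v x (rfl | h) (rfl | h')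
      exacts [Or.inl rfl, Or.inr h', Or.inr h, Or.inr ⟨h.1, h'.2⟩]
  mul' := by
    have left : ∀ {u v : FreeMonoid ℕ}, ¬ u.toList <:+: w → ¬ (u * v).toList <:+: w :=
      fun h hc => h ((List.prefix_append _ _).isInfix.trans hc)
    have right : ∀ {u v : FreeMonoid ℕ}, ¬ v.toList <:+: w → ¬ (u * v).toList <:+: w :=
      fun h hc => h ((List.suffix_append _ _).isInfix.trans hc)
    rintro u v x y (rfl | h) (rfl | h')
    · exact Or.inl rfl
    · exact Or.inr ⟨right h'.1, right h'.2⟩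
    · exact Or.inr ⟨left h.1, left h.2⟩
    · exact Or.inr ⟨left h.1, left h.2⟩

/-- The monoid of factors of the word `w` with a zero adjoined. -/
abbrev FactorMonoid (w : List ℕ) : Type := (factorCon w).Quotient

theorem holds_factorMonoid_iff {w u v : List ℕ} :
    Holds (FactorMonoid w) u v ↔ ∀ g : ℕ → List ℕ, u.flatMap g = v.flatMap g ∨
      ¬ u.flatMap g <:+: w ∧ ¬ v.flatMap g <:+: w := by
  have key : ∀ (g : ℕ → List ℕ) (l : List ℕ),
      (l.map fun z => ((FreeMonoid.ofList (g z) : FreeMonoid ℕ) : FactorMonoid w)).prod =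
        ((FreeMonoid.ofList (l.flatMap g) : FreeMonoid ℕ) : FactorMonoid w) := by
    intro g l
    induction l with
    | nil => rfl
    | cons a l ih => rw [List.map_cons, List.prod_cons, ih]; rfl
  constructor
  · intro h g
    have e := h fun z => ((FreeMonoid.ofList (g z) : FreeMonoid ℕ) : FactorMonoid w)
    rw [key, key, Con.eq] at e
    exact e
  · intro h f
    have : ∀ z, ∃ l : List ℕ, ((FreeMonoid.ofList l : FreeMonoid ℕ) : FactorMonoid w) = f z :=
      fun z => Con.induction_on (f z) fun x => ⟨x.toList, rfl⟩
    choose g hg using this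
    have hf : f = fun z => ((FreeMonoid.ofList (g z) : FreeMonoid ℕ) : FactorMonoid w) :=
      funext fun z => (hg z).symm
    rw [hf, key, key, Con.eq]
    exact h g

theorem not_holds_factorMonoid {w v : List ℕ} (h : v ≠ w) : ¬ Holds (FactorMonoid w) w v := by
  intro hc
  rcases holds_factorMonoid_iff.1 hc (fun z => [z]) with e | ⟨e, -⟩
  · simp only [List.flatMap_singleton'] at e
    exact h e.symm
  · simp only [List.flatMap_singleton'] at e
    exact e List.infix_rfl

theorem mul_count_le_count_flatMap (g : ℕ → List ℕ) (x c : ℕ) (u : List ℕ) :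
    u.count x * (g x).count c ≤ (u.flatMap g).count c := by
  induction u with
  | nil => simp
  | cons a u ih =>
    rw [List.flatMap_cons, List.count_append]
    by_cases ha : a = x
    · subst ha
      rw [List.count_cons_self, add_mul, one_mul]
      omega
    · rw [List.count_cons_of_ne ha]
      omega

theorem count_lt_of_flatMap_infix {w u : List ℕ} {k x c : ℕ} {g : ℕ → List ℕ}
    (hw : w.count c < k) (hu : k ≤ u.count x) (h : u.flatMap g <:+: w) : c ∉ g x := by
  intro hc
  have h1 := mul_count_le_count_flatMap g x c u
  have h2 := h.sublist.count_le c
  have h3 := List.count_pos_iff.2 hc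
  have := Nat.mul_le_mul hu h3
  omega

/-- A factor monoid satisfies every identity in which `x` occurs too often, provided that the
identity becomes trivial when `x` is deleted. -/
theorem holds_factorMonoid_of_count {w u v : List ℕ} {k x : ℕ}
    (hw : ∀ c ∈ w, w.count c < k) (hk : 0 < k) (hu : k ≤ u.count x) (hv : k ≤ v.count x)
    (huv : u.filter (· ≠ x) = v.filter (· ≠ x)) : Holds (FactorMonoid w) u v := by
  have hw' : ∀ c, w.count c < k := fun c => by
    by_cases hc : c ∈ w
    · exact hw c hc
    · rwa [List.count_eq_zero.2 hc]
  rw [holds_factorMonoid_iff]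
  intro g
  by_cases hg : g x = []
  · left
    have : ∀ l : List ℕ, l.flatMap g = (l.filter (· ≠ x)).flatMap g := by
      intro l
      induction l with
      | nil => rfl
      | cons a l ih =>
        by_cases ha : a = x
        · subst ha; simpa [hg] using ih
        · simpa [ha] using ih
    rw [this u, this v, huv]
  · obtain ⟨c, hc⟩ := List.exists_mem_of_ne_nil _ hg
    exact Or.inr ⟨fun h => count_lt_of_flatMap_infix (hw' c) hu h hc,
      fun h => count_lt_of_flatMap_infix (hw' c) hv h hc⟩

theorem append_comm_of_forall_eq {a b : List ℕ} {x : ℕ} (ha : ∀ z ∈ a, z = x)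
    (hb : ∀ z ∈ b, z = x) : a ++ b = b ++ a := by
  rw [List.eq_replicate_of_mem ha, List.eq_replicate_of_mem hb, List.replicate_append_replicate,
    List.replicate_append_replicate, add_comm]

/-- If only the letter `0` occurs repeatedly in `w`, the factor monoid of `w` satisfies every
identity that follows from the commutation of two repeated letters `0` and `1`. -/
theorem holds_factorMonoid_of_comm {w u v : List ℕ} {k : ℕ}
    (hw : ∀ c ∈ w, c ≠ 0 → w.count c < k) (hk : 0 < k)
    (hu : k ≤ u.count 0 ∧ k ≤ u.count 1) (hv : k ≤ v.count 0 ∧ k ≤ v.count 1)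
    (huv : ∀ g : ℕ → List ℕ, g 0 ++ g 1 = g 1 ++ g 0 → u.flatMap g = v.flatMap g) :
    Holds (FactorMonoid w) u v := by
  rw [holds_factorMonoid_iff]
  intro g
  by_cases hg : g 0 ++ g 1 = g 1 ++ g 0
  · exact Or.inl (huv g hg)
  · have hw' : ∀ c, c ≠ 0 → w.count c < k := fun c hc0 => by
      by_cases hc : c ∈ w
      · exact hw c hc hc0
      · rwa [List.count_eq_zero.2 hc]
    have key : ∀ l : List ℕ, k ≤ l.count 0 ∧ k ≤ l.count 1 → ¬ l.flatMap g <:+: w := by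
      intro l hl h
      apply hg
      apply append_comm_of_forall_eq (x := 0)
      · intro z hz
        by_contra hc
        exact count_lt_of_flatMap_infix (hw' z hc) hl.1 h hz
      · intro z hz
        by_contra hc
        exact count_lt_of_flatMap_infix (hw' z hc) hl.2 h hz
    exact Or.inr ⟨key u hu, key v hv⟩

end FactorMonoid

namespace Variety

theorem Id.flatMap {V : Variety.{u}} {u v : List ℕ} (h : V.Id u v) (g : ℕ → List ℕ) :
    V.Id (u.flatMap g) (v.flatMap g) := by
  intro M _ hM f
  have key : ∀ l : List ℕ,
      ((l.flatMap g).map f).prod = (l.map fun z => ((g z).map f).prod).prod := by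
    intro l
    induction l with
    | nil => rfl
    | cons a l ih => simp [ih]
  rw [key, key]
  exact h M hM _

theorem Id.append {V : Variety.{u}} {u v : List ℕ} (h : V.Id u v) (p q : List ℕ) :
    V.Id (p ++ u ++ q) (p ++ v ++ q) := by
  intro M _ hM f
  simp [h M hM f]

/-- The word `w` is an isoterm for `V`: it forms no nontrivial identity of `V`. -/
def IsIsoterm (V : Variety.{u}) (w : List ℕ) : Prop := ∀ v, V.Id w v → v = w

/-- Padding an identity of a factor to an identity of `w` shows that factors of an isoterm are
isoterms. Thus, after any substitution, the two sides of an identity are equal or both fail to be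
factors. -/
theorem IsIsoterm.has {V : Variety.{u}} {w : List ℕ} (h : V.IsIsoterm w) :
    V.Has (FactorMonoid w) := by
  rw [has_iff]
  have key : ∀ u v : List ℕ, V.Id u v → u <:+: w → u = v := by
    rintro u v huv ⟨p, q, rfl⟩
    have := h _ (huv.append p q)
    rw [List.append_assoc, List.append_assoc, List.append_cancel_left_eq,
      List.append_cancel_right_eq] at this
    exact this.symm
  intro u v huv
  rw [holds_factorMonoid_iff]
  intro g
  by_contra hc
  rw [not_or] at hc
  have h1 := mt (key _ _ (huv.flatMap g)) hc.1
  have h2 := mt (key _ _ (huv.symm.flatMap g)) (Ne.symm hc.1)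
  exact hc.2 ⟨h1, h2⟩

theorem Id.pow_count {V : Variety.{u}} {u v : List ℕ} (h : V.Id u v) (x : ℕ) {M : Type u}
    [Monoid M] (hM : V.Contains M) (m : M) : m ^ u.count x = m ^ v.count x := by
  have e := h M hM fun z => if z = x then m else 1
  rw [prod_map_eq_pow _ x u (by intro z _ hz; simp [hz]),
    prod_map_eq_pow _ x v (by intro z _ hz; simp [hz])] at e
  simpa using e

/-- If `x` were missing from `v`, erasing the other letters would give `x^k ≈ 1` with `k > 0`,
making every element a unit. -/
theorem Id.mem {V : Variety.{u}} (hV : ¬ V.IsGroupVariety) {u v : List ℕ} (h : V.Id u v)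
    {x : ℕ} (hx : x ∈ u) : x ∈ v := by
  by_contra hc
  apply hV
  intro M _ hM m
  have e := h.pow_count x hM m
  rw [List.count_eq_zero.2 hc, pow_zero] at e
  exact IsUnit.of_pow_eq_one e (List.count_pos_iff.2 hx).ne'

theorem holds_of_pow_count {N : Type u} [CommMonoid N] {u v : List ℕ}
    (h : ∀ (z : ℕ) (m : N), m ^ u.count z = m ^ v.count z) : Holds N u v := by
  have key : ∀ (f : ℕ → N) (l : List ℕ) (s : Finset ℕ), l.toFinset ⊆ s →
      (l.map f).prod = ∏ z ∈ s, f z ^ l.count z := by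
    intro f l s hs
    rw [Finset.prod_list_map_count]
    apply Finset.prod_subset hs
    intro z _ hz
    rw [List.count_eq_zero.2 (by simpa using hz), pow_zero]
  intro f
  rw [key f u (u.toFinset ∪ v.toFinset) Finset.subset_union_left,
    key f v (u.toFinset ∪ v.toFinset) Finset.subset_union_right]
  exact Finset.prod_congr rfl fun z _ => h z _

/-- The exponent identity `x ^ i ≈ x ^ j` holds in `V`. -/
def PowId (V : Variety.{u}) (i j : ℕ) : Prop :=
  ∀ (M : Type u) [Monoid M], V.Contains M → ∀ m : M, m ^ i = m ^ j

theorem PowId.add {V : Variety.{u}} {i j : ℕ} (h : V.PowId i j) (k : ℕ) :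
    V.PowId (i + k) (j + k) := fun M _ hM m => by rw [pow_add, pow_add, h M hM m]

theorem PowId.symm {V : Variety.{u}} {i j : ℕ} (h : V.PowId i j) : V.PowId j i :=
  fun M _ hM m => (h M hM m).symm

theorem PowId.trans {V : Variety.{u}} {i j k : ℕ} (h : V.PowId i j) (h' : V.PowId j k) :
    V.PowId i k := fun M _ hM m => (h M hM m).trans (h' M hM m)

theorem PowId.add_mul {V : Variety.{u}} {i p : ℕ} (h : V.PowId i (i + p)) (k : ℕ) :
    V.PowId i (i + k * p) := by
  induction k with
  | zero => intro M _ _ m; simp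
  | succ k ih =>
    refine h.trans ?_
    have := ih.add p
    rwa [show i + k * p + p = i + (k + 1) * p by ring] at this

/-- Otherwise the cyclic group of order `p` lies in `V`. So does `{1, 0}`, the factor monoid of the
empty word, and `x² ≈ x` and `x^p ≈ 1` separate the two. -/
theorem IsChainVariety.exists_powId_not_modEq {V : Variety.{u}} (hc : V.IsChainVariety)
    (hg : ¬ V.IsGroupVariety) {p : ℕ} (hp : 2 ≤ p) :
    ∃ i j, V.PowId i j ∧ ¬ i ≡ j [MOD p] := by
  by_contra hno
  push Not at hno
  have h1 : V.Has (FactorMonoid []) := by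
    apply IsIsoterm.has
    intro v hv
    exact List.eq_nil_iff_forall_not_mem.2 fun x hx => by simpa using hv.symm.mem hg hx
  have hpow : ∀ (m : Multiplicative (ZMod p)) (i : ℕ),
      m ^ i = Multiplicative.ofAdd ((i : ZMod p) * m.toAdd) := by
    intro m i
    rw [← nsmul_eq_mul]
    rfl
  have h2 : V.Has (Multiplicative (ZMod p)) := by
    rw [has_iff]
    intro u v huv
    apply holds_of_pow_count
    intro z m
    have := hno _ _ fun M _ hM m => huv.pow_count z hM m
    rw [hpow, hpow, (ZMod.natCast_eq_natCast_iff _ _ _).2 this]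
  refine hc.not_separated h1 h2 (u := [0, 0]) (v := [0]) (u' := List.replicate p 0) (v' := [])
    ?_ ?_ ?_ ?_
  · exact holds_factorMonoid_of_count (k := 1) (x := 0) (by simp) (by simp) (by simp) (by simp)
      (by simp)
  · intro h
    have := h fun _ => Multiplicative.ofAdd (1 : ZMod p)
    have : Fact (1 < p) := ⟨hp⟩
    simp_all
  · intro f
    simp [hpow]
  · exact fun h => not_holds_factorMonoid (by simp; omega) h.symm

/-- Let `p` be the least positive period. If `p ≠ 1`, some period `q` is not divisible by `p`, and
reducing modulo `p` gives the smaller positive period `q % p`. -/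
theorem IsChainVariety.exists_powId_succ {V : Variety.{u}} (hc : V.IsChainVariety)
    (hg : ¬ V.IsGroupVariety) : ∃ n, V.PowId n (n + 1) := by
  have period : ∀ p, 2 ≤ p → ∃ i q, V.PowId i (i + q) ∧ ¬ p ∣ q := by
    intro p hp
    obtain ⟨i, j, hij, hne⟩ := hc.exists_powId_not_modEq hg hp
    rcases le_total i j with h | h
    · obtain ⟨q, rfl⟩ := Nat.exists_eq_add_of_le h
      exact ⟨i, q, hij, fun hd => hne (by simpa using (Nat.modEq_zero_iff_dvd.2 hd).symm.add_left i)⟩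
    · obtain ⟨q, rfl⟩ := Nat.exists_eq_add_of_le h
      exact ⟨j, q, hij.symm, fun hd => hne (by simpa using (Nat.modEq_zero_iff_dvd.2 hd).add_left j)⟩
  classical
  have hex : ∃ p, 0 < p ∧ ∃ i, V.PowId i (i + p) := by
    obtain ⟨i, q, h, hq⟩ := period 2 le_rfl
    exact ⟨q, Nat.pos_of_ne_zero (by rintro rfl; simp at hq), i, h⟩
  obtain ⟨hp, i, hi⟩ := Nat.find_spec hex
  have hmin := fun m => Nat.find_min (m := m) hex
  generalize Nat.find hex = p at hp hi hmin
  by_cases hp1 : p = 1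
  · exact ⟨i, hp1 ▸ hi⟩
  exfalso
  obtain ⟨j, q, hj, hq⟩ := period p (by omega)
  have hr : 0 < q % p := Nat.pos_of_ne_zero fun h => hq (Nat.dvd_of_mod_eq_zero h)
  refine hmin (q % p) (Nat.mod_lt _ hp) ⟨hr, i + j, ?_⟩
  have e1 := hj.add i
  have e2 := (hi.add_mul (q / p)).add (j + q % p)
  have e3 := Nat.div_add_mod' q p
  rw [show j + i = i + j by ring] at e1
  rw [show j + q + i = i + q / p * p + (j + q % p) by omega] at e1
  rw [show i + j + q % p = i + (j + q % p) by ring]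
  exact e1.trans e2.symm

theorem PowId.pow_eq {V : Variety.{u}} {n : ℕ} (h : V.PowId n (n + 1)) {M : Type u} [Monoid M]
    (hM : V.Contains M) (m : M) {k : ℕ} (hk : n ≤ k) : m ^ k = m ^ (k + 1) := by
  obtain ⟨d, rfl⟩ := Nat.exists_eq_add_of_le hk
  have := h.add d M hM m
  rwa [show n + 1 + d = n + d + 1 by ring] at this

theorem absorbs_of_comm {n : ℕ} {M : Type u} [Monoid M] (hM : ∀ a b : M, a * b = b * a)
    (hn : ∀ (m : M) (k : ℕ), n ≤ k → m ^ k = m ^ (k + 1)) : Absorbs n M := by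
  intro f u x hx
  have : ∃ r, (u.map f).prod = r * f x ^ u.count x := by
    clear hx
    induction u with
    | nil => exact ⟨1, by simp⟩
    | cons a u ih =>
      obtain ⟨r, hr⟩ := ih
      by_cases ha : a = x
      · subst ha
        exact ⟨r, by rw [List.map_cons, List.prod_cons, hr, List.count_cons_self, pow_succ,
          hM (f a), mul_assoc]⟩
      · exact ⟨f a * r, by simp [ha, hr, mul_assoc]⟩
  obtain ⟨r, hr⟩ := this
  rw [hr, mul_assoc, ← pow_succ, ← hn _ _ hx]

end Variety

end MonoidVar

/-! ### Varieties of idempotent monoids. -/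

namespace MonoidVar

section Bands

/-- The two-element left zero semigroup. -/
def LeftZero : Type := Bool

instance instSemigroupLeftZero : Semigroup LeftZero where
  mul x _ := x
  mul_assoc _ _ _ := rfl

/-- The two-element left zero semigroup with an identity element adjoined. -/
abbrev LeftRegularMonoid : Type := WithOne LeftZero

theorem leftRegularMonoid_mul {m : LeftRegularMonoid} (hm : m ≠ 1) (n : LeftRegularMonoid) :
    m * n = m := by
  rcases m with _ | m
  · exact absurd rfl hm
  · rcases n with _ | n <;> rfl

theorem leftRegularMonoid_mul_mul (m n : LeftRegularMonoid) : m * n * m = m * n := by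
  by_cases hm : m = 1
  · subst hm; simp
  · rw [leftRegularMonoid_mul hm, leftRegularMonoid_mul hm]

theorem exists_first_ne_one {M : Type u} [Monoid M] (f : ℕ → M) (u : List ℕ) :
    (∀ z ∈ u, f z = 1) ∨ ∃ p x q, u = p ++ x :: q ∧ (∀ z ∈ p, f z = 1) ∧ f x ≠ 1 := by
  induction u with
  | nil => left; simp
  | cons a u ih =>
    by_cases ha : f a = 1
    · rcases ih with h | ⟨p, x, q, rfl, hp, hx⟩
      · left
        simpa [ha] using h
      · right
        exact ⟨a :: p, x, q, rfl, by simpa [ha] using hp, hx⟩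
    · right
      exact ⟨[], a, u, rfl, by simp, ha⟩

/-- In a band a product of copies of `a` and `b` beginning with `a` is `a`, `ab` or `aba`, and each
becomes `ab` after multiplication by `b`. -/
theorem band_mul_prod_mul {M : Type u} [Monoid M] (hM : ∀ m : M, m * m = m) {a b : M}
    {h : ℕ → M} (hh : ∀ z, h z = a ∨ h z = b ∨ h z = 1) (w : List ℕ) :
    a * (w.map h).prod * b = a * b := by
  have key : a * (w.map h).prod = a ∨ a * (w.map h).prod = a * b ∨
      a * (w.map h).prod = a * b * a := by
    induction w using List.reverseRecOn with
    | nil => left; simp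
    | append_singleton w c ih =>
      rw [List.map_append, List.prod_append, ← mul_assoc, List.map_singleton, List.prod_singleton]
      rcases ih with e | e | e <;> rcases hh c with e' | e' | e' <;> rw [e, e'] <;>
        simp [hM, mul_assoc]
      right; left
      simpa [mul_assoc] using hM (a * b)
  rcases key with e | e | e <;> rw [e]
  · rw [mul_assoc, hM]
  · simpa [mul_assoc] using hM (a * b)

namespace Variety

/-- In `LeftRegularMonoid` a word takes the value of its first letter not sent to `1`. An identity
failing there, restricted to the two first letters `x ≠ y`, equates a word beginning with `x` and
one beginning with `y`; in bands this yields `bab = ab`. -/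
theorem coAbsorbs_one_of_not_has {V : Variety.{u}} (hg : ¬ V.IsGroupVariety)
    (hb : ∀ (M : Type u) [Monoid M], V.Contains M → ∀ m : M, m * m = m)
    (hV : ¬ V.Has LeftRegularMonoid) (M : Type u) [Monoid M] (hM : V.Contains M) :
    CoAbsorbs 1 M := by
  rw [has_iff] at hV
  unfold Holds at hV
  push Not at hV
  obtain ⟨u, v, huv, f, hf⟩ := hV
  have one : ∀ {l : List ℕ}, (∀ z ∈ l, f z = 1) → (l.map f).prod = 1 := fun h =>
    List.prod_eq_one (by simpa using h)
  have first : ∀ {p q : List ℕ} {x : ℕ}, (∀ z ∈ p, f z = 1) → f x ≠ 1 →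
      ((p ++ x :: q).map f).prod = f x := by
    intro p q x hp hx
    rw [List.map_append, List.prod_append, one hp, one_mul, List.map_cons, List.prod_cons,
      leftRegularMonoid_mul hx]
  have hexu : ∃ p x q, u = p ++ x :: q ∧ (∀ z ∈ p, f z = 1) ∧ f x ≠ 1 := by
    refine (exists_first_ne_one f u).resolve_left fun hu => hf ?_
    rw [one hu, one fun z hz => hu z (huv.symm.mem hg hz)]
  have hexv : ∃ p x q, v = p ++ x :: q ∧ (∀ z ∈ p, f z = 1) ∧ f x ≠ 1 := by
    refine (exists_first_ne_one f v).resolve_left fun hv => hf ?_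
    rw [one hv, one fun z hz => hv z (huv.mem hg hz)]
  obtain ⟨p, x, q, rfl, hp, hx⟩ := hexu
  obtain ⟨p', y, q', rfl, hp', hy⟩ := hexv
  rw [first hp hx, first hp' hy] at hf
  have hyx : y ≠ x := by rintro rfl; exact hf rfl
  have hM1 := hb M hM
  have law : ∀ a b : M, b * a * b = a * b := by
    intro a b
    let h : ℕ → M := fun z => if z = x then a else if z = y then b else 1
    have hab : ∀ z, h z = a ∨ h z = b ∨ h z = 1 := by
      intro z
      simp only [h]
      split_ifs <;> simp
    have hba : ∀ z, h z = b ∨ h z = a ∨ h z = 1 := fun z => or_left_comm.1 (hab z)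
    have hone : ∀ {l : List ℕ}, (∀ z ∈ l, f z = 1) → (l.map h).prod = 1 := by
      intro l hl
      apply List.prod_eq_one
      simp only [List.mem_map, forall_exists_index, and_imp, forall_apply_eq_imp_iff₂, h]
      intro z hz
      rw [if_neg, if_neg]
      · rintro rfl; exact hy (hl _ hz)
      · rintro rfl; exact hx (hl _ hz)
    have e := huv M hM h
    rw [List.map_append, List.map_append, List.prod_append, List.prod_append, hone hp, hone hp',
      one_mul, one_mul, List.map_cons, List.map_cons, List.prod_cons, List.prod_cons] at e
    have h1 : h x = a := by simp [h]
    have h2 : h y = b := by simp [h, hyx]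
    rw [h1, h2] at e
    have e1 := band_mul_prod_mul hM1 hab (q ++ [x])
    have e2 := band_mul_prod_mul hM1 hba q'
    simp only [List.map_append, List.map_singleton, List.prod_append, List.prod_singleton, h1,
      ← mul_assoc] at e1
    rw [← e2, ← e, e1]
  intro f u x hx
  obtain ⟨p, q, rfl⟩ := List.append_of_mem (List.count_pos_iff.1 hx)
  rw [List.map_append, List.map_cons, List.prod_append, List.prod_cons, ← mul_assoc, ← mul_assoc,
    law, ← mul_assoc]

theorem IsChainVariety.band_absorbs {V : Variety.{u}} (hc : V.IsChainVariety)
    (hg : ¬ V.IsGroupVariety)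
    (hb : ∀ (M : Type u) [Monoid M], V.Contains M → ∀ m : M, m * m = m) :
    (∀ (M : Type u) [Monoid M], V.Contains M → CoAbsorbs 1 M) ∨
      ∀ (M : Type u) [Monoid M], V.Contains M → Absorbs 1 M := by
  by_cases h1 : V.Has LeftRegularMonoid
  · right
    have h2 : ¬ V.op.Has LeftRegularMonoid := by
      rw [op_has]
      intro h2
      -- The monoid satisfies `xyx ≈ xy`, its opposite satisfies `yxy ≈ xy`, and neither satisfies
      -- the other law.
      refine hc.not_separated h1 h2 (u := [0, 1, 0]) (v := [0, 1]) (u' := [1, 0, 1])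
        (v' := [0, 1]) ?_ ?_ ?_ ?_
      · intro f
        simpa [mul_assoc] using leftRegularMonoid_mul_mul (f 0) (f 1)
      · rw [holds_mulOpposite]
        intro h
        cases h fun z => if z = 0 then ((true : Bool) : WithOne Bool) else
          ((false : Bool) : WithOne Bool)
      · rw [holds_mulOpposite]
        intro f
        simpa [mul_assoc] using leftRegularMonoid_mul_mul (f 1) (f 0)
      · intro h
        cases h fun z => if z = 0 then ((true : Bool) : WithOne Bool) else
          ((false : Bool) : WithOne Bool)
    intro M _ hM
    exact absorbs_mulOpposite_iff.1 (coAbsorbs_one_of_not_has (fun h => hg h.op)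
      (fun N _ hN m => by
        have := hb Nᵐᵒᵖ hN (MulOpposite.op m)
        exact MulOpposite.op_injective this) h2 _ (contains_op_op.2 hM))
  · left
    exact coAbsorbs_one_of_not_has hg hb h1

end Variety

end Bands

end MonoidVar

/-! ### The monoid `E0` and chain varieties that are neither commutative nor idempotent. -/

namespace MonoidVar

/-- The monoid `{1, e, t, 0}` with `e² = e`, `te = t` and `et = t² = 0`. -/
inductive E0 : Type
  | one | e | t | zero
  deriving DecidableEq

namespace E0

/-- The multiplication of `E0`. -/
def mul : E0 → E0 → E0
  | one, x => x
  | x, one => x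
  | e, e => e
  | t, e => t
  | _, _ => zero

instance instMonoid : Monoid E0 where
  mul := mul
  one := one
  mul_assoc x y z := by cases x <;> cases y <;> cases z <;> rfl
  one_mul x := by cases x <;> rfl
  mul_one x := by cases x <;> rfl

/-- The elements `1` and `e` form a submonoid. -/
def IsLow (x : E0) : Prop := x = one ∨ x = e

theorem isLow_mul {x y : E0} (hx : IsLow x) (hy : IsLow y) : IsLow (x * y) := by
  rcases hx with rfl | rfl <;> rcases hy with rfl | rfl
  exacts [Or.inl rfl, Or.inr rfl, Or.inr rfl, Or.inr rfl]

theorem isLow_of_mul {x y : E0} (h : IsLow (x * y)) : IsLow x ∧ IsLow y := by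
  cases x <;> cases y <;> rcases h with h | h <;> first | (cases h; done) | simp [IsLow]

theorem eq_one_of_mul {x y : E0} (h : x * y = one) : x = one ∧ y = one := by
  cases x <;> cases y <;> first | (cases h; done) | exact ⟨rfl, rfl⟩

theorem of_mul_t_mul_ne_zero {x y : E0} (h : x * t * y ≠ zero) : x = one ∧ IsLow y := by
  cases x <;> cases y <;>
    first | exact absurd rfl h | exact ⟨rfl, Or.inl rfl⟩ | exact ⟨rfl, Or.inr rfl⟩

theorem isLow_prod {f : ℕ → E0} {l : List ℕ} (h : ∀ z ∈ l, IsLow (f z)) :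
    IsLow (l.map f).prod := by
  induction l with
  | nil => exact Or.inl rfl
  | cons a l ih =>
    rw [List.map_cons, List.prod_cons]
    exact isLow_mul (h a List.mem_cons_self) (ih fun z hz => h z (List.mem_cons_of_mem _ hz))

theorem isLow_of_prod {f : ℕ → E0} {l : List ℕ} (h : IsLow (l.map f).prod) :
    ∀ z ∈ l, IsLow (f z) := by
  induction l with
  | nil => simp
  | cons a l ih =>
    rw [List.map_cons, List.prod_cons] at h
    simpa using ⟨(isLow_of_mul h).1, ih (isLow_of_mul h).2⟩

theorem eq_one_of_prod {f : ℕ → E0} {l : List ℕ} (h : (l.map f).prod = one) :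
    ∀ z ∈ l, f z = one := by
  induction l with
  | nil => simp
  | cons a l ih =>
    rw [List.map_cons, List.prod_cons] at h
    simpa using ⟨(eq_one_of_mul h).1, ih (eq_one_of_mul h).2⟩

theorem ne_zero_of_prod {f : ℕ → E0} {l : List ℕ} (h : (l.map f).prod ≠ zero) :
    ∀ z ∈ l, f z ≠ zero := by
  induction l with
  | nil => simp
  | cons a l ih =>
    rw [List.map_cons, List.prod_cons] at h
    refine List.forall_mem_cons.2 ⟨fun ha => h ?_, ih fun hl => h ?_⟩
    · rw [ha]; cases (l.map f).prod <;> rfl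
    · rw [hl]; cases f a <;> rfl

theorem prod_eq_one {f : ℕ → E0} {l : List ℕ} (h : ∀ z ∈ l, f z = one) :
    (l.map f).prod = one :=
  List.prod_eq_one (List.forall_mem_map.2 h)

end E0

namespace Variety

/-- A chain variety that contains a non-group, a non-commutative monoid and a monoid that is not a
band. -/
structure IsProperChain (V : Variety.{u}) : Prop where
  chain : V.IsChainVariety
  not_group : ¬ V.IsGroupVariety
  not_comm : ¬ ∀ (M : Type u) [Monoid M], V.Contains M → ∀ a b : M, a * b = b * a
  not_band : ¬ ∀ (M : Type u) [Monoid M], V.Contains M → ∀ m : M, m * m = m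

theorem IsProperChain.op {V : Variety.{u}} (h : V.IsProperChain) : V.op.IsProperChain where
  chain := h.chain.op
  not_group := fun hc => h.not_group hc.op
  not_comm := fun hc => h.not_comm fun _ _ hM a b =>
    MulOpposite.op_injective (hc _ (contains_op_op.2 hM) (MulOpposite.op b) (MulOpposite.op a))
  not_band := fun hc => h.not_band fun _ _ hM a =>
    MulOpposite.op_injective (hc _ (contains_op_op.2 hM) (MulOpposite.op a))

/-- Iterating `x^i ≈ x^j` raises the exponent `i` beyond `n`, where one more factor changes nothing.
-/
theorem powId_of_lt {V : Variety.{u}} {n i j : ℕ} (hn : V.PowId n (n + 1)) (hij : i < j)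
    (h : V.PowId i j) : V.PowId i (i + 1) := by
  intro M _ hM m
  obtain ⟨d, rfl⟩ := Nat.exists_eq_add_of_lt hij
  have e : V.PowId i (i + n * (d + 1)) := PowId.add_mul (p := d + 1) h n
  have hle : n ≤ i + n * (d + 1) := by nlinarith
  have e2 := hn.pow_eq hM m hle
  rw [e M hM m, e2, pow_succ, ← e M hM m, ← pow_succ]

theorem IsProperChain.count_eq_one {V : Variety.{u}} (h : V.IsProperChain) {u v : List ℕ}
    (huv : V.Id u v) {x : ℕ} (hx : u.count x = 1) : v.count x = 1 := by
  by_contra hc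
  have h0 : v.count x ≠ 0 := by
    have : x ∈ v := huv.mem h.not_group (List.count_pos_iff.1 (by omega))
    exact (List.count_pos_iff.2 this).ne'
  obtain ⟨n, hn⟩ := h.chain.exists_powId_succ h.not_group
  have hp : V.PowId 1 (v.count x) := fun M _ hM m => by
    rw [← huv.pow_count x hM m, hx]
  have := powId_of_lt hn (show 1 < v.count x by omega) hp
  apply h.not_band
  intro M _ hM m
  simpa [pow_succ] using (this M hM m).symm

theorem exists_split {u : List ℕ} {t : ℕ} (h : u.count t = 1) :
    ∃ p q, u = p ++ t :: q ∧ t ∉ p ∧ t ∉ q := by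
  obtain ⟨p, q, rfl, hp⟩ := List.eq_append_cons_of_mem
    (List.count_pos_iff.1 (show 0 < u.count t by omega))
  rw [List.count_append, List.count_cons_self] at h
  exact ⟨p, q, rfl, hp, List.count_eq_zero.1 (by omega)⟩

/-- Substituting `1` for all letters except a linear letter `t` and a letter `x`. -/
theorem Id.pow_law {V : Variety.{u}} {p q p' q' : List ℕ} {t : ℕ}
    (h : V.Id (p ++ t :: q) (p' ++ t :: q')) (ht : t ∉ p ∧ t ∉ q ∧ t ∉ p' ∧ t ∉ q') {x : ℕ}
    (hx : x ≠ t) {M : Type u} [Monoid M] (hM : V.Contains M) (a b : M) :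
    a ^ p.count x * b * a ^ q.count x = a ^ p'.count x * b * a ^ q'.count x := by
  have e := h M hM fun z => if z = t then b else if z = x then a else 1
  have key : ∀ l : List ℕ, t ∉ l →
      (l.map fun z => if z = t then b else if z = x then a else 1).prod = a ^ l.count x := by
    intro l hl
    rw [prod_map_eq_pow _ x l]
    · simp [hx]
    · intro z hz hzx
      rw [if_neg (by rintro rfl; exact hl hz), if_neg hzx]
  simpa [key _ ht.1, key _ ht.2.1, key _ ht.2.2.1, key _ ht.2.2.2, mul_assoc] using e

/-- If the linear letters `s` and `t` changed order, erasing all other letters would give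
commutativity. -/
theorem IsProperChain.exists_split_two {V : Variety.{u}} (h : V.IsProperChain)
    {p q r v : List ℕ} {s t : ℕ} (huv : V.Id (p ++ s :: (q ++ t :: r)) v)
    (hs : (p ++ s :: (q ++ t :: r)).count s = 1) (ht : (p ++ s :: (q ++ t :: r)).count t = 1) :
    ∃ p' q' r', v = p' ++ s :: (q' ++ t :: r') ∧ (s ∉ p' ∧ s ∉ q' ∧ s ∉ r') ∧
      t ∉ p' ∧ t ∉ q' ∧ t ∉ r' := by
  have hst : t ≠ s := by
    rintro rfl
    simp at hs
    omega
  obtain ⟨p', w, rfl, hp', hw⟩ := exists_split (h.count_eq_one huv hs)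
  have ht' := h.count_eq_one huv ht
  by_cases htw : t ∈ w
  · obtain ⟨q', r', rfl⟩ := List.append_of_mem htw
    simp only [List.count_append, List.count_cons_self, List.count_cons_of_ne hst.symm] at ht'
    simp only [List.mem_append, List.mem_cons, not_or] at hw
    exact ⟨p', q', r', rfl, ⟨hp', hw.1, hw.2.2⟩, List.count_eq_zero.1 (by omega),
      List.count_eq_zero.1 (by omega), List.count_eq_zero.1 (by omega)⟩
  · exfalso
    apply h.not_comm
    intro M _ hM a b
    have hs' : s ∉ p ∧ s ∉ q ++ t :: r := by
      rw [List.count_append, List.count_cons_self] at hs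
      exact ⟨List.count_eq_zero.1 (by omega), List.count_eq_zero.1 (by omega)⟩
    have e := huv.pow_law ⟨hs'.1, hs'.2, hp', hw⟩ hst hM b a
    simp only [List.count_append, List.count_cons_self, List.count_cons_of_ne hst.symm] at ht ht' e
    have e1 : q.count t + (r.count t + 1) = 1 := by omega
    rw [e1, show p.count t = 0 by omega, List.count_eq_zero.2 htw,
      show p'.count t = 1 by rw [List.count_eq_zero.2 htw] at ht'; omega] at e
    simpa using e

theorem eq_of_count_eq_singleton {l : List ℕ} {x : ℕ} (h : l.count x = 1)
    (h' : ∀ z ∈ l, z = x) : l = [x] := by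
  have := List.eq_replicate_of_mem h'
  rw [this, List.count_replicate_self] at h
  rw [this, h]
  rfl

/-- The word `xy` is an isoterm. If `x²` were one too, `x² ≈ x³` and `xy ≈ yx` would separate the
two factor monoids. So `x² ≈ x^k` with `k > 2`, and `powId_of_lt` applies. -/
theorem IsProperChain.powId_two {V : Variety.{u}} (h : V.IsProperChain) : V.PowId 2 3 := by
  obtain ⟨n, hn⟩ := h.chain.exists_powId_succ h.not_group
  have h1 : V.IsIsoterm [0, 1] := by
    intro v hv
    obtain ⟨p, q, r, rfl, hs, ht⟩ :=
      h.exists_split_two (p := []) (q := []) (r := []) (s := 0) (t := 1) hv (by simp) (by simp)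
    have hm : ∀ z, z ∈ p ++ 0 :: (q ++ 1 :: r) → z = 0 ∨ z = 1 := fun z hz => by
      simpa using hv.symm.mem h.not_group hz
    have nil : ∀ l : List ℕ, l ⊆ p ++ 0 :: (q ++ 1 :: r) → 0 ∉ l → 1 ∉ l → l = [] := by
      intro l hl h0 h1
      refine List.eq_nil_iff_forall_not_mem.2 fun z hz => ?_
      rcases hm z (hl hz) with rfl | rfl
      exacts [h0 hz, h1 hz]
    rw [nil p (fun z hz => by simp [hz]) hs.1 ht.1, nil q (fun z hz => by simp [hz]) hs.2.1 ht.2.1,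
      nil r (fun z hz => by simp [hz]) hs.2.2 ht.2.2]
    rfl
  have h2 : ¬ V.IsIsoterm [0, 0] := by
    intro h2
    refine h.chain.not_separated h1.has h2.has (u := [0, 0]) (v := [0, 0, 0]) (u' := [0, 1])
      (v' := [1, 0]) ?_ ?_ ?_ ?_
    · exact holds_factorMonoid_of_count (k := 2) (x := 0) (by simp) (by simp) (by simp) (by simp)
        (by simp)
    · exact not_holds_factorMonoid (by simp)
    · refine holds_factorMonoid_of_comm (k := 1) (by simp) (by simp) (by simp) (by simp) ?_
      intro g hg
      simpa using hg
    · exact not_holds_factorMonoid (by simp)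
  unfold IsIsoterm at h2
  push Not at h2
  obtain ⟨v, hv, hne⟩ := h2
  have hrep : v = List.replicate v.length 0 :=
    List.eq_replicate_of_mem fun z hz => by simpa using hv.symm.mem h.not_group hz
  have hp : V.PowId 2 v.length := fun M _ hM m => by
    have := hv.pow_count 0 hM m
    rw [hrep, List.count_replicate_self] at this
    simpa using this
  have h0 : v.length ≠ 0 := by
    intro hc
    have := hv.mem h.not_group (x := 0) (by simp)
    rw [List.length_eq_zero_iff.1 hc] at this
    simp at this
  have h1' : v.length ≠ 1 := by
    intro hc
    have := h.count_eq_one hv.symm (x := 0) (by rw [hrep, hc]; simp)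
    simp at this
  have h2' : v.length ≠ 2 := by
    intro hc
    rw [hc] at hrep
    exact hne hrep
  exact powId_of_lt hn (show 2 < v.length by omega) hp

theorem PowId.pow_eq_sq {V : Variety.{u}} (h : V.PowId 2 3) {M : Type u} [Monoid M]
    (hM : V.Contains M) (m : M) (k : ℕ) : m ^ (k + 2) = m ^ 2 := by
  induction k with
  | zero => rfl
  | succ k ih => rw [← h.pow_eq hM m (by omega), ih]

/-- A nonzero value in `E0` that uses `t` comes from a single `t` with only ones before it. An
identity could spoil this only by moving an `e`-letter from the right of a linear letter to its
left, and such an identity implies the law. -/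
theorem IsProperChain.sq_law_of_not_has {V : Variety.{u}} (h : V.IsProperChain)
    (hE : ¬ V.Has E0) (M : Type u) [Monoid M] (hM : V.Contains M) (a b : M) :
    a ^ 2 * b * a ^ 2 = b * a ^ 2 := by
  by_contra hlaw
  apply hE
  rw [has_iff]
  have key : ∀ (u v : List ℕ) (f : ℕ → E0), V.Id u v → (u.map f).prod ≠ E0.zero →
      (v.map f).prod = (u.map f).prod := by
    intro u v f huv hu
    have hmem : ∀ {z}, z ∈ v → z ∈ u := fun hz => huv.symm.mem h.not_group hz
    have hmem' : ∀ {z}, z ∈ u → z ∈ v := fun hz => huv.mem h.not_group hz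
    by_cases ht : ∃ y ∈ u, f y = E0.t
    · obtain ⟨y, hy, hfy⟩ := ht
      obtain ⟨p, q, rfl⟩ := List.append_of_mem hy
      rw [List.map_append, List.prod_append, List.map_cons, List.prod_cons, hfy, ← mul_assoc]
        at hu ⊢
      obtain ⟨hp, hq⟩ := E0.of_mul_t_mul_ne_zero hu
      have hp' := E0.eq_one_of_prod hp
      have hq' := E0.isLow_of_prod hq
      have hyp : y ∉ p := fun hc => by have := hp' y hc; rw [hfy] at this; cases this
      have hyq : y ∉ q := fun hc => by
        rcases hq' y hc with e | e <;> rw [hfy] at e <;> cases e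
      have hone : (p ++ y :: q).count y = 1 := by
        simp [List.count_eq_zero.2 hyp, List.count_eq_zero.2 hyq]
      obtain ⟨r, s, rfl, hyr, hys⟩ := exists_split (h.count_eq_one huv hone)
      have hlow : ∀ z ∈ r ++ s, E0.IsLow (f z) := by
        intro z hz
        have h1 : z ∈ p ++ y :: q := hmem (by
          rcases List.mem_append.1 hz with hz | hz <;> simp [hz])
        have h2 : z ≠ y := by
          rintro rfl
          exact (List.mem_append.1 hz).elim hyr hys
        simp only [List.mem_append, List.mem_cons, h2, false_or] at h1
        rcases h1 with h1 | h1
        · exact Or.inl (hp' z h1)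
        · exact hq' z h1
      have hr : ∀ z ∈ r, f z = E0.one := by
        intro x hx
        refine (hlow x (by simp [hx])).resolve_right fun hfx => hlaw ?_
        have hxy : x ≠ y := by rintro rfl; exact hyr hx
        have hxp : x ∉ p := fun hc => by have := hp' x hc; rw [hfx] at this; cases this
        have hxq : x ∈ q := by
          have : x ∈ p ++ y :: q := hmem (by simp [hx])
          simpa [hxp, hxy] using this
        -- Using `a ^ 2` makes positive exponents irrelevant.
        have e := huv.pow_law ⟨hyp, hyq, hyr, hys⟩ hxy hM (a ^ 2) b
        rw [List.count_eq_zero.2 hxp, pow_zero, one_mul] at e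
        have red : ∀ k, 0 < k → (a ^ 2) ^ k = a ^ 2 := by
          intro k hk
          obtain ⟨d, rfl⟩ := Nat.exists_eq_add_of_le' hk
          rw [← pow_mul, show 2 * (d + 1) = 2 * d + 2 by ring, h.powId_two.pow_eq_sq hM]
        rw [red _ (List.count_pos_iff.2 hxq), red _ (List.count_pos_iff.2 hx)] at e
        have e2 := congrArg (· * a ^ 2) e
        simp only [mul_assoc] at e2
        rw [← pow_succ, red _ (Nat.succ_pos _), ← pow_add,
          h.powId_two.pow_eq_sq hM a 2] at e2
        rw [e2, mul_assoc]
      have hs : E0.IsLow (s.map f).prod := E0.isLow_prod fun z hz => hlow z (by simp [hz])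
      rw [List.map_append, List.prod_append, List.map_cons, List.prod_cons, hfy, ← mul_assoc, hp,
        E0.prod_eq_one hr]
      rcases hs with e | e <;> rcases hq with e' | e' <;> rw [e, e'] <;> rfl
    · push Not at ht
      have hlow : ∀ z ∈ u, E0.IsLow (f z) := by
        intro z hz
        have h1 := ht z hz
        have h2 := E0.ne_zero_of_prod hu z hz
        unfold E0.IsLow
        cases hf : f z <;> simp_all
      have hu' := E0.isLow_prod hlow
      have hv' := E0.isLow_prod (f := f) (l := v) fun z hz => hlow z (hmem hz)
      rcases hu' with e | e <;> rcases hv' with e' | e' <;> rw [e, e']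
      · have := E0.prod_eq_one (l := v) fun z hz => E0.eq_one_of_prod e z (hmem hz)
        rw [← e', this]
      · have := E0.prod_eq_one (l := u) fun z hz => E0.eq_one_of_prod e' z (hmem' hz)
        rw [← e, this]
  intro u v huv f
  by_cases hu : (u.map f).prod = E0.zero
  · by_cases hv : (v.map f).prod = E0.zero
    · rw [hu, hv]
    · exact key v u f huv.symm hv
  · exact (key u v f huv hu).symm

theorem sq_law_op {V : Variety.{u}}
    (hlaw : ∀ (M : Type u) [Monoid M], V.op.Contains M → ∀ a b : M,
      a ^ 2 * b * a ^ 2 = b * a ^ 2) (M : Type u) [Monoid M] (hM : V.Contains M) (a b : M) :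
    a ^ 2 * b * a ^ 2 = a ^ 2 * b := by
  have := congrArg MulOpposite.unop
    (hlaw Mᵐᵒᵖ (contains_op_op.2 hM) (MulOpposite.op a) (MulOpposite.op b))
  simpa [mul_assoc] using this

theorem eq_replicate_append {p q : List ℕ} (hp : 1 ∉ p) (hq : 1 ∉ q)
    (hw : ∀ z ∈ p ++ 1 :: q, z = 0 ∨ z = 1) :
    p = List.replicate (p.count 0) 0 ∧ q = List.replicate (q.count 0) 0 := by
  have key : ∀ l : List ℕ, 1 ∉ l → l ⊆ p ++ 1 :: q → l = List.replicate (l.count 0) 0 := by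
    intro l hl hs
    have := List.eq_replicate_of_mem (l := l) (a := 0) fun z hz =>
      (hw z (hs hz)).resolve_right (by rintro rfl; exact hl hz)
    rw [this, List.count_replicate_self]
  exact ⟨key p hp fun z hz => by simp [hz], key q hq fun z hz => by simp [hz]⟩

/-- Comparison with `E0` excludes its opposite, giving `x²yx ≈ x²y`, and excludes `xyx` as an
isoterm. The resulting law `xyx ≈ x^i y x^j` then yields `xyx ≈ xyx²`, so `absorbs_two` applies. -/
theorem IsProperChain.absorbs_two_of_has {V : Variety.{u}} (h : V.IsProperChain) (hE : V.Has E0)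
    (M : Type u) [Monoid M] (hM : V.Contains M) : Absorbs 2 M := by
  have hEop : ¬ V.op.Has E0 := by
    rw [op_has]
    intro hEop
    refine h.chain.not_separated hE hEop (u := [0, 0, 1, 0, 0]) (v := [0, 0, 1])
      (u' := [0, 0, 1, 0, 0]) (v' := [1, 0, 0]) ?_ ?_ ?_ ?_
    · intro f
      simp only [List.map_cons, List.map_nil, List.prod_cons, List.prod_nil]
      cases f 0 <;> cases f 1 <;> rfl
    · rw [holds_mulOpposite]
      intro hc
      cases hc fun z => if z = 0 then E0.e else E0.t
    · rw [holds_mulOpposite]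
      intro f
      simp only [List.reverse_cons, List.reverse_nil, List.nil_append, List.cons_append,
        List.map_cons, List.map_nil, List.prod_cons, List.prod_nil]
      cases f 0 <;> cases f 1 <;> rfl
    · intro hc
      cases hc fun z => if z = 0 then E0.e else E0.t
  have law := sq_law_op (h.op.sq_law_of_not_has hEop)
  have hiso : ¬ V.IsIsoterm [0, 1, 0] := by
    intro hiso
    refine h.chain.not_separated hE hiso.has (u := [0, 0, 1]) (v := [0, 1, 0])
      (u' := [0, 0, 0, 1]) (v' := [1, 0, 0, 0]) ?_ ?_ ?_ ?_
    · intro f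
      simp only [List.map_cons, List.map_nil, List.prod_cons, List.prod_nil]
      cases f 0 <;> cases f 1 <;> rfl
    · exact fun hc => not_holds_factorMonoid (by simp) hc.symm
    · exact holds_factorMonoid_of_count (k := 3) (x := 0) (by simp) (by simp) (by simp) (by simp)
        (by simp)
    · intro hc
      cases hc fun z => if z = 0 then E0.e else E0.t
  unfold IsIsoterm at hiso
  push Not at hiso
  obtain ⟨v, hv, hne⟩ := hiso
  obtain ⟨p, q, rfl, hp, hq⟩ := exists_split (h.count_eq_one hv (x := 1) (by simp))
  obtain ⟨ep, eq⟩ := eq_replicate_append hp hq fun z hz => by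
    have := hv.symm.mem h.not_group hz
    simp only [List.mem_cons, List.not_mem_nil, or_false] at this
    omega
  have hlaw : ∀ (N : Type u) [Monoid N], V.Contains N → ∀ a b : N,
      a * b * a = a ^ p.count 0 * b * a ^ q.count 0 := by
    intro N _ hN a b
    simpa using hv.pow_law (p := [0]) (q := [0]) (t := 1) (x := 0)
      ⟨by simp, by simp, hp, hq⟩ (by simp) hN a b
  have hcount : (p ++ 1 :: q).count 0 = p.count 0 + q.count 0 := by simp
  have hcount1 : (p ++ 1 :: q).count 0 ≠ 1 := by
    intro hc
    have := h.count_eq_one hv.symm hc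
    simp at this
  have h2 : ∀ x y : M, x ^ 2 * y = x ^ 2 * y * x := by
    intro x y
    conv_rhs => rw [← law M hM, mul_assoc, ← pow_succ, ← h.powId_two M hM, law M hM]
  refine absorbs_two (fun x y => ?_) h2
  -- With `i = 0` the law would fail in `E0`, where `ete = 0` but `te^j = t`.
  have hpos : p.count 0 ≠ 0 := by
    intro hc
    have e := congrArg ULift.down (hlaw _ hE ⟨E0.e⟩ ⟨E0.t⟩)
    have low : ∀ k, E0.t * E0.e ^ k = E0.t := by
      intro k
      induction k with
      | zero => rfl
      | succ k ih => rw [pow_succ, ← mul_assoc, ih]; rfl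
    rw [hc, pow_zero, one_mul] at e
    have e' : E0.e * E0.t * E0.e = E0.t * E0.e ^ q.count 0 := e
    rw [low] at e'
    cases e'
  by_cases h1 : p.count 0 = 1
  · have hq1 : q.count 0 ≠ 1 := by
      intro hc
      rw [ep, eq, h1, hc] at hne
      exact hne rfl
    obtain ⟨k, hk⟩ := Nat.exists_eq_add_of_le' (show 2 ≤ q.count 0 by omega)
    rw [hlaw M hM, h1, hk, pow_one, h.powId_two.pow_eq_sq hM]
  · obtain ⟨k, hk⟩ := Nat.exists_eq_add_of_le' (show 2 ≤ p.count 0 by omega)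
    have e : x * y * x = x ^ 2 * y := by
      rw [hlaw M hM, hk, h.powId_two.pow_eq_sq hM]
      clear hk hcount
      generalize q.count 0 = j
      induction j with
      | zero => rw [pow_zero, mul_one]
      | succ j ih => rw [pow_succ x j, ← mul_assoc, ih, ← h2]
    conv_rhs => rw [pow_two, ← mul_assoc, e, ← h2]
    exact e

end Variety

end MonoidVar

/-! ### The case of central squares, and the conclusion. -/

namespace MonoidVar
namespace Variety

/-- Three copies of a letter produce a central square, which swallows any later copy. -/
theorem absorbs_three_of_law {M : Type u} [Monoid M] (h3 : ∀ a : M, a ^ 2 = a ^ 3)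
    (hcen : ∀ a b : M, a ^ 2 * b = b * a ^ 2)
    (hlaw : ∀ a b c : M, a * b * a * c * a = a ^ 2 * b * c) : Absorbs 3 M := by
  intro f u x hx
  obtain ⟨p, s, rfl, hp⟩ := List.eq_append_cons_of_mem
    (List.count_pos_iff.1 (show 0 < u.count x by omega))
  rw [List.count_append, List.count_cons_self, List.count_eq_zero.2 hp] at hx
  obtain ⟨q, r, w, rfl⟩ := exists_eq_append_of_two_le_count (show 2 ≤ s.count x by omega)
  simp only [List.map_append, List.map_cons, List.prod_append, List.prod_cons]
  have e1 := hlaw (f x) (q.map f).prod (r.map f).prod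
  generalize (q.map f).prod = Q at *
  generalize (r.map f).prod = R at *
  generalize (p.map f).prod = P at *
  generalize (w.map f).prod = W at *
  generalize f x = X at *
  have e2 : X * Q * X * R * X * W * X = X * Q * X * R * X * W := by
    rw [e1, mul_assoc (X ^ 2) Q R, mul_assoc (X ^ 2), hcen, mul_assoc, ← pow_succ, ← h3]
  simpa [mul_assoc] using congrArg (P * ·) e2

/-- A nontrivial identity for `xyxzx` has the form `xyxzx ≈ x^i y x^j z x^k` with exponents not all
`1`. An exponent at least `2` gives a central square, hence `x²yz`. -/
theorem IsProperChain.absorbs_three {V : Variety.{u}} (h : V.IsProperChain)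
    (hcen : ∀ (M : Type u) [Monoid M], V.Contains M → ∀ a b : M, a ^ 2 * b = b * a ^ 2)
    (hiso : ¬ V.IsIsoterm [0, 1, 0, 2, 0]) (M : Type u) [Monoid M] (hM : V.Contains M) :
    Absorbs 3 M := by
  unfold IsIsoterm at hiso
  push Not at hiso
  obtain ⟨v, hv, hne⟩ := hiso
  obtain ⟨p, q, r, rfl, hs, ht⟩ := h.exists_split_two (p := [0]) (q := [0]) (r := [0])
    (s := 1) (t := 2) hv (by simp) (by simp)
  have hm : ∀ z ∈ p ++ 1 :: (q ++ 2 :: r), z = 0 ∨ z = 1 ∨ z = 2 := fun z hz => by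
    have := hv.symm.mem h.not_group hz
    simp only [List.mem_cons, List.not_mem_nil, or_false] at this
    omega
  have hzero : ∀ l : List ℕ, l ⊆ p ++ 1 :: (q ++ 2 :: r) → 1 ∉ l → 2 ∉ l → ∀ z ∈ l, z = 0 := by
    intro l hl h1 h2 z hz
    rcases hm z (hl hz) with rfl | rfl | rfl
    exacts [rfl, absurd hz h1, absurd hz h2]
  have hp := hzero p (fun z hz => by simp [hz]) hs.1 ht.1
  have hq := hzero q (fun z hz => by simp [hz]) hs.2.1 ht.2.1
  have hr := hzero r (fun z hz => by simp [hz]) hs.2.2 ht.2.2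
  have hpow : ∀ (l : List ℕ) (f : ℕ → M), (∀ z ∈ l, z = 0) →
      (l.map f).prod = f 0 ^ l.count 0 := fun l f hl =>
    prod_map_eq_pow f 0 l fun z hz hz0 => absurd (hl z hz) hz0
  have hlaw : ∀ a b c : M, a * b * a * c * a =
      a ^ p.count 0 * b * a ^ q.count 0 * c * a ^ r.count 0 := by
    intro a b c
    have := hv M hM fun z => if z = 1 then b else if z = 2 then c else a
    simp only [List.map_append, List.map_cons, List.prod_append, List.prod_cons, hpow p _ hp,
      hpow q _ hq, hpow r _ hr] at this
    simpa [mul_assoc] using this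
  have hnot : ¬ (p.count 0 = 1 ∧ q.count 0 = 1 ∧ r.count 0 = 1) := by
    rintro ⟨h1, h2, h3⟩
    rw [eq_of_count_eq_singleton h1 hp, eq_of_count_eq_singleton h2 hq,
      eq_of_count_eq_singleton h3 hr] at hne
    exact hne rfl
  have hcount : (p ++ 1 :: (q ++ 2 :: r)).count 0 = p.count 0 + (q.count 0 + r.count 0) := by simp
  have hcount1 : (p ++ 1 :: (q ++ 2 :: r)).count 0 ≠ 1 := by
    intro hc
    have := h.count_eq_one hv.symm hc
    simp at this
  have hcount0 : (p ++ 1 :: (q ++ 2 :: r)).count 0 ≠ 0 :=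
    (List.count_pos_iff.2 (hv.mem h.not_group (by simp))).ne'
  rw [hcount] at hcount0 hcount1
  have hsq := fun (m : M) k => h.powId_two.pow_eq_sq hM m k
  have hcen := hcen M hM
  have h3 : ∀ m : M, m ^ 2 * m = m ^ 2 := fun m => by rw [← pow_succ, ← h.powId_two M hM]
  have h2k : ∀ (m : M) (k : ℕ), m ^ 2 * m ^ k = m ^ 2 := fun m k => by
    rw [← pow_add, add_comm, hsq]
  apply absorbs_three_of_law (fun a => h.powId_two M hM a) hcen
  generalize p.count 0 = i at *
  generalize q.count 0 = j at *
  generalize r.count 0 = k at *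
  have hdel : ∀ (a x : M) (k : ℕ), a ^ 2 * x * a ^ k = a ^ 2 * x := fun a x k => by
    rw [hcen, mul_assoc, h2k]
  have of_two : (∀ a b : M, a * b * a = a ^ 2 * b) →
      ∀ a b c : M, a * b * a * c * a = a ^ 2 * b * c := by
    intro h2 a b c
    have := hdel a (b * c) 1
    rw [pow_one, ← mul_assoc] at this
    rw [h2, this]
  have of_sq : ∀ (a b c : M) (j k : ℕ), a ^ 2 * b * a ^ j * c * a ^ k = a ^ 2 * b * c := by
    intro a b c j k
    rw [hdel, mul_assoc (a ^ 2), hdel]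
  by_cases hi : 2 ≤ i
  · obtain ⟨i, rfl⟩ := Nat.exists_eq_add_of_le' hi
    intro a b c
    rw [hlaw, hsq, of_sq]
  by_cases hj : 2 ≤ j
  · obtain ⟨j, rfl⟩ := Nat.exists_eq_add_of_le' hj
    intro a b c
    rw [hlaw, hsq, ← hcen, ← mul_assoc, h2k, mul_assoc (a ^ 2), hdel]
  by_cases hk : 2 ≤ k
  · obtain ⟨k, rfl⟩ := Nat.exists_eq_add_of_le' hk
    intro a b c
    rw [hlaw, hsq, ← hcen, ← mul_assoc, ← mul_assoc, ← mul_assoc, h2k, hdel]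
  -- Now exactly two exponents are `1` and the third is `0`. Setting `z = 1` if `k = 0`, or `y = 1`
  -- if `k = 1`, gives `xyx ≈ x²y`.
  apply of_two
  by_cases hk0 : k = 0
  · obtain ⟨rfl, rfl⟩ : i = 1 ∧ j = 1 := by omega
    intro a b
    have e := hlaw a b 1
    rw [hk0] at e
    simp only [pow_one, pow_zero, mul_one] at e
    rw [← e, mul_assoc (a * b), ← pow_two, ← hcen, ← mul_assoc, h3]
  · obtain rfl : k = 1 := by omega
    intro a c
    have e := hlaw a 1 c
    have e' : a ^ i * 1 * a ^ j = a := by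
      rw [mul_one, ← pow_add, show i + j = 1 by omega, pow_one]
    rw [e'] at e
    simp only [pow_one, mul_one] at e
    have := hdel a c 1
    rw [pow_one, pow_two] at this
    rw [← e, this, pow_two]

theorem IsIsoterm.of_append {V : Variety.{u}} {w p q : List ℕ} (h : V.IsIsoterm (p ++ w ++ q)) :
    V.IsIsoterm w := fun _ hv =>
  List.append_cancel_left (List.append_cancel_right (h _ (hv.append p q)))

theorem IsIsoterm.exponents_eq_one {V : Variety.{u}} (h : V.IsIsoterm [0, 1, 0]) {i j : ℕ}
    (hij : ∀ (M : Type u) [Monoid M], V.Contains M → ∀ a b : M, a * b * a = a ^ i * b * a ^ j) :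
    i = 1 ∧ j = 1 := by
  have e := h (List.replicate i 0 ++ 1 :: List.replicate j 0) fun M _ hM f => by
    simpa [mul_assoc] using hij M hM (f 0) (f 1)
  rcases i with _ | _ | i
  · simp at e
  · rcases j with _ | _ | j <;> simp [List.replicate_succ] at e ⊢
  · simp [List.replicate_succ] at e

/-- If `xyx` is an isoterm, the distribution of a letter `x` that occurs twice over the three blocks
determined by two linear letters is an invariant. -/
theorem IsIsoterm.count_blocks {V : Variety.{u}} (h : V.IsIsoterm [0, 1, 0])
    {p q r p' q' r' : List ℕ} {s t x : ℕ}
    (huv : V.Id (p ++ s :: (q ++ t :: r)) (p' ++ s :: (q' ++ t :: r')))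
    (hs : (s ∉ p ∧ s ∉ q ∧ s ∉ r) ∧ s ∉ p' ∧ s ∉ q' ∧ s ∉ r')
    (ht : (t ∉ p ∧ t ∉ q ∧ t ∉ r) ∧ t ∉ p' ∧ t ∉ q' ∧ t ∉ r') (hst : s ≠ t) (hxs : x ≠ s)
    (hxt : x ≠ t) (h2 : p.count x + q.count x + r.count x = 2) (hp : p.count x ≤ 1)
    (hq : q.count x ≤ 1) (hr : r.count x ≤ 1) :
    p'.count x = p.count x ∧ q'.count x = q.count x ∧ r'.count x = r.count x := by
  have iff : ∀ {a b a' b' : List ℕ} {t : ℕ}, V.Id (a ++ t :: b) (a' ++ t :: b') →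
      (t ∉ a ∧ t ∉ b ∧ t ∉ a' ∧ t ∉ b') → x ≠ t →
      ((a.count x = 1 ∧ b.count x = 1) ↔ (a'.count x = 1 ∧ b'.count x = 1)) := by
    intro a b a' b' t hid ht hxt
    constructor
    · rintro ⟨h1, h2⟩
      refine h.exponents_eq_one fun M _ hM m n => ?_
      simpa [h1, h2] using hid.pow_law ht hxt hM m n
    · rintro ⟨h1, h2⟩
      refine h.exponents_eq_one fun M _ hM m n => ?_
      simpa [h1, h2] using (hid.pow_law ht hxt hM m n).symm
  have e1 := iff huv (by simp [hs, hst]) hxs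
  have e2 := iff (a := p ++ s :: q) (b := r) (a' := p' ++ s :: q') (b' := r') (t := t)
    (by simpa using huv) (by simp [ht, hst.symm]) hxt
  simp only [List.count_append, List.count_cons_of_ne hxs.symm,
    List.count_cons_of_ne hxt.symm] at e1 e2
  omega

theorem IsProperChain.exists_perm_blocks {V : Variety.{u}} (h : V.IsProperChain)
    (hiso : V.IsIsoterm [0, 1, 0]) {p q r v : List ℕ}
    (huv : V.Id (p ++ 2 :: (q ++ 3 :: r)) v) (hp : ∀ z ∈ p, z = 0 ∨ z = 1)
    (hq : ∀ z ∈ q, z = 0 ∨ z = 1) (hr : ∀ z ∈ r, z = 0 ∨ z = 1)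
    (hcount : ∀ x, x = 0 ∨ x = 1 → p.count x + q.count x + r.count x = 2 ∧ p.count x ≤ 1 ∧
      q.count x ≤ 1 ∧ r.count x ≤ 1) :
    ∃ p' q' r', v = p' ++ 2 :: (q' ++ 3 :: r') ∧ p'.Perm p ∧ q'.Perm q ∧ r'.Perm r := by
  have hnot : ∀ {l : List ℕ}, (∀ z ∈ l, z = 0 ∨ z = 1) → ∀ {s : ℕ}, s ≠ 0 → s ≠ 1 → s ∉ l :=
    fun hl _ h0 h1 hs => (hl _ hs).elim h0 h1
  have hs : 2 ∉ p ∧ 2 ∉ q ∧ 2 ∉ r :=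
    ⟨hnot hp (by simp) (by simp), hnot hq (by simp) (by simp), hnot hr (by simp) (by simp)⟩
  have ht : 3 ∉ p ∧ 3 ∉ q ∧ 3 ∉ r :=
    ⟨hnot hp (by simp) (by simp), hnot hq (by simp) (by simp), hnot hr (by simp) (by simp)⟩
  obtain ⟨p', q', r', rfl, hs', ht'⟩ := h.exists_split_two (s := 2) (t := 3) huv
    (by simp [List.count_eq_zero.2 hs.1, List.count_eq_zero.2 hs.2.1, List.count_eq_zero.2 hs.2.2])
    (by simp [List.count_eq_zero.2 ht.1, List.count_eq_zero.2 ht.2.1, List.count_eq_zero.2 ht.2.2])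
  have key : ∀ x, p'.count x = p.count x ∧ q'.count x = q.count x ∧ r'.count x = r.count x := by
    intro x
    by_cases hx : x = 0 ∨ x = 1
    · have := hcount x hx
      exact hiso.count_blocks huv ⟨hs, hs'⟩ ⟨ht, ht'⟩ (by simp) (by omega) (by omega) this.1
        this.2.1 this.2.2.1 this.2.2.2
    · by_cases h2 : x = 2
      · subst h2
        simp [List.count_eq_zero.2, hs, hs']
      by_cases h3 : x = 3
      · subst h3
        simp [List.count_eq_zero.2, ht, ht']
      have hxu : x ∉ p ++ 2 :: (q ++ 3 :: r) := by
        intro hc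
        simp only [List.mem_append, List.mem_cons, h2, h3, false_or] at hc
        rcases hc with hc | hc | hc
        exacts [hx (hp x hc), hx (hq x hc), hx (hr x hc)]
      have hxv : x ∉ p' ++ 2 :: (q' ++ 3 :: r') := fun hc => hxu (huv.symm.mem h.not_group hc)
      simp only [List.mem_append, List.mem_cons, not_or] at hxu hxv
      simp [List.count_eq_zero.2, hxu, hxv]
  exact ⟨p', q', r', rfl, List.perm_iff_count.2 fun x => (key x).1,
    List.perm_iff_count.2 fun x => (key x).2.1, List.perm_iff_count.2 fun x => (key x).2.2⟩

theorem eq_or_eq_of_perm_pair {l : List ℕ} {a b : ℕ} (h : l.Perm [a, b]) :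
    l = [a, b] ∨ l = [b, a] := by
  have hl := h.length_eq
  match l, hl with
  | [c, d], _ =>
    have hc : c = a ∨ c = b := by simpa using h.subset (List.mem_cons_self)
    rcases hc with rfl | rfl
    · left
      simpa using h
    · right
      have := h.trans (List.Perm.swap _ _ _)
      simpa using this

/-- The left sides of the last three laws are not isoterms. Any nontrivial identity for one of them
preserves the content of the three blocks cut out by the linear letters. Only one block has two
letters, so the identity must be the swap. -/
theorem IsProperChain.dLaws {V : Variety.{u}} (h : V.IsProperChain)
    (hcen : ∀ (M : Type u) [Monoid M], V.Contains M → ∀ a b : M, a ^ 2 * b = b * a ^ 2)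
    (hiso : V.IsIsoterm [0, 1, 0, 2, 0]) (M : Type u) [Monoid M] (hM : V.Contains M) :
    DLaws M := by
  have hiso3 : V.IsIsoterm [0, 1, 0] := IsIsoterm.of_append (p := []) (q := [2, 0]) hiso
  have not_iso : ∀ w w' : List ℕ, w' ≠ w → (∀ c ∈ w, w.count c < 3) →
      (2 ≤ w.count 0 ∧ 2 ≤ w.count 1) → (2 ≤ w'.count 0 ∧ 2 ≤ w'.count 1) →
      (∀ g : ℕ → List ℕ, g 0 ++ g 1 = g 1 ++ g 0 → w.flatMap g = w'.flatMap g) →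
      ∃ v, V.Id w v ∧ v ≠ w := by
    intro w w' hne hw hu hv hg
    have : ¬ V.IsIsoterm w := by
      intro hw'
      -- In `xyxzx` only one letter repeats, so its factor monoid satisfies the swap `w ≈ w'`. No
      -- letter occurs three times in `w`, so the factor monoid of `w` satisfies `xyxzx ≈ xyx²zx`.
      refine h.chain.not_separated hiso.has hw'.has (u := w) (v := w') (u' := [0, 1, 0, 2, 0])
        (v' := [0, 1, 0, 0, 2, 0]) ?_ ?_ ?_ ?_
      · exact holds_factorMonoid_of_comm (k := 2) (by simp) (by simp) hu hv hg
      · exact not_holds_factorMonoid hne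
      · exact holds_factorMonoid_of_count (k := 3) (x := 0) hw (by simp) (by simp) (by simp)
          (by simp)
      · exact not_holds_factorMonoid (by simp)
    unfold IsIsoterm at this
    push Not at this
    exact this
  refine ⟨fun x => h.powId_two M hM x, hcen M hM, fun x y z t => ?_, fun x y z t => ?_,
    fun x y z t => ?_⟩
  · obtain ⟨v, hv, hne⟩ := not_iso [0, 1, 2, 0, 3, 1] [1, 0, 2, 0, 3, 1] (by simp) (by decide)
      (by decide) (by decide) fun g hg => by
        simp only [List.flatMap_cons, ← List.append_assoc, hg]
    obtain ⟨p, q, r, rfl, hp, hq, hr⟩ := h.exists_perm_blocks hiso3 (p := [0, 1]) (q := [0])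
      (r := [1]) hv (by simp) (by simp) (by simp) (by rintro x (rfl | rfl) <;> simp)
    rw [List.perm_singleton.1 hq, List.perm_singleton.1 hr] at hv hne
    rcases eq_or_eq_of_perm_pair hp with rfl | rfl
    · exact absurd rfl hne
    · simpa [mul_assoc] using
        hv M hM fun i => if i = 0 then x else if i = 1 then y else if i = 2 then z else t
  · obtain ⟨v, hv, hne⟩ := not_iso [0, 2, 1, 3, 0, 1] [0, 2, 1, 3, 1, 0] (by simp) (by decide)
      (by decide) (by decide) fun g hg => by
        simp only [List.flatMap_cons, List.flatMap_nil, List.append_nil, hg]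
    obtain ⟨p, q, r, rfl, hp, hq, hr⟩ := h.exists_perm_blocks hiso3 (p := [0]) (q := [1])
      (r := [0, 1]) hv (by simp) (by simp) (by simp) (by rintro x (rfl | rfl) <;> simp)
    rw [List.perm_singleton.1 hq, List.perm_singleton.1 hp] at hv hne
    rcases eq_or_eq_of_perm_pair hr with rfl | rfl
    · exact absurd rfl hne
    · simpa [mul_assoc] using
        hv M hM fun i => if i = 0 then x else if i = 1 then y else if i = 2 then t else z
  · obtain ⟨v, hv, hne⟩ := not_iso [1, 2, 0, 1, 3, 0] [1, 2, 1, 0, 3, 0] (by simp) (by decide)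
      (by decide) (by decide) fun g hg => by
        simp only [List.flatMap_cons]
        rw [← List.append_assoc (g 0), hg, List.append_assoc]
    obtain ⟨p, q, r, rfl, hp, hq, hr⟩ := h.exists_perm_blocks hiso3 (p := [1]) (q := [0, 1])
      (r := [0]) hv (by simp) (by simp) (by simp) (by rintro x (rfl | rfl) <;> simp)
    rw [List.perm_singleton.1 hp, List.perm_singleton.1 hr] at hv hne
    rcases eq_or_eq_of_perm_pair hq with rfl | rfl
    · exact absurd rfl hne
    · simpa [mul_assoc] using
        hv M hM fun i => if i = 0 then x else if i = 1 then y else if i = 2 then z else t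

theorem IsProperChain.exists_isFinitelyGenerated {V : Variety.{u}} (h : V.IsProperChain) :
    ∃ W : Variety.{u}, W.IsFinitelyGenerated ∧ V ≤ W := by
  by_cases h1 : V.Has E0
  · exact exists_isFinitelyGenerated_of_absorbs (h.absorbs_two_of_has h1)
  by_cases h2 : V.op.Has E0
  · exact exists_isFinitelyGenerated_of_coAbsorbs (n := 2) fun M _ hM => by
      have := h.op.absorbs_two_of_has h2 _ (contains_op_op.2 hM)
      rw [← absorbs_mulOpposite_iff] at this
      intro f u x hx
      -- Dualising twice leaves the double opposite of `M`, which is identified with `M` here.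
      have key := this (fun i => MulOpposite.op (MulOpposite.op (f i))) u x hx
      have e : ∀ l : List ℕ, ((l.map fun i => MulOpposite.op (MulOpposite.op (f i))).prod).unop.unop
          = (l.map f).prod := by
        intro l
        induction l with
        | nil => rfl
        | cons a l ih => simp [ih]
      simpa [e] using congrArg (fun m => m.unop.unop) key
  have law := sq_law_op (h.op.sq_law_of_not_has h2)
  have hcen : ∀ (M : Type u) [Monoid M], V.Contains M → ∀ a b : M, a ^ 2 * b = b * a ^ 2 :=
    fun M _ hM a b => by rw [← law M hM, h.sq_law_of_not_has h1 M hM]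
  by_cases h3 : V.IsIsoterm [0, 1, 0, 2, 0]
  · exact ⟨_, isFinitelyGenerated_generatedBy (M := BrandtMonoid), le_trans
      (fun M hM => varietyD_contains_iff.2 (h.dLaws hcen h3 M hM)) varietyD_le⟩
  · exact exists_isFinitelyGenerated_of_absorbs (h.absorbs_three hcen h3)

theorem IsChainVariety.exists_isFinitelyGenerated {V : Variety.{u}} (hc : V.IsChainVariety)
    (hg : ¬ V.IsGroupVariety) : ∃ W : Variety.{u}, W.IsFinitelyGenerated ∧ V ≤ W := by
  by_cases h1 : ∀ (M : Type u) [Monoid M], V.Contains M → ∀ a b : M, a * b = b * a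
  · obtain ⟨n, hn⟩ := hc.exists_powId_succ hg
    exact exists_isFinitelyGenerated_of_absorbs fun M _ hM =>
      absorbs_of_comm (h1 M hM) fun m _ hk => hn.pow_eq hM m hk
  by_cases h2 : ∀ (M : Type u) [Monoid M], V.Contains M → ∀ m : M, m * m = m
  · rcases hc.band_absorbs hg h2 with h | h
    · exact exists_isFinitelyGenerated_of_coAbsorbs h
    · exact exists_isFinitelyGenerated_of_absorbs h
  · exact IsProperChain.exists_isFinitelyGenerated ⟨hc, hg, h1, h2⟩

end Variety
end MonoidVar

theorem corollary7p5 :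
    (∀ V : MonoidVar.Variety.{u}, ¬ V.IsGroupVariety → V.IsChainVariety →
      (∃ W : MonoidVar.Variety.{u}, W.IsFinitelyGenerated ∧ V ≤ W) ∧ V.IsLocallyFinite) ∧
    MonoidVar.varietyD.{u} ≤
      MonoidVar.Variety.generatedBy (ULift.{u} MonoidVar.BrandtMonoid) ∧
    MonoidVar.varietyK.{u} ≤
      MonoidVar.Variety.generatedBy (ULift.{u} MonoidVar.FiveMonoid) := by
  refine ⟨fun V hg hc => ?_, MonoidVar.varietyD_le, MonoidVar.varietyK_le⟩
  obtain ⟨W, hW, hVW⟩ := hc.exists_isFinitelyGenerated hg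
  exact ⟨⟨W, hW, hVW⟩, hW.isLocallyFinite hVW⟩
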